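/- A *triangulation of $S^3$* is a finite simplicial complex $T$ whose geometric realization is homeomorphic to $S^3$. It is *flag* if every nonempty set of pairwise adjacent vertices spans a simplex. With $f_i(T)$ the number of $i$-dimensional simplices, put $$\gamma_2(T)=f_3(T)-2f_2(T)+4f_1(T)-8f_0(T)+16 .$$ A triangulation $T_2$ of $S^3$ *dominates* a triangulation $T_1$ of $S^3$, written $T_1\preceq T_2$, if there is a simplicial map $T_2\to T_1$ of nonzero degree. A flag triangulation $T$ of $S^3$ with $\gamma_2(T)>0$ is *basic* if every flag triangulation $T'$ of $S^3$ with $\gamma_2(T')>0$ and $T'\preceq T$ is isomorphic to $T$. Let $T_{10}$ be the join of two pentagons (5-cycles). Let $T_{12}$ be the flag simplicial complex with vertices $0,1,\dots,11$ whose simplices are the cliques of the graph with the following neighbourhoods: $$\begin{aligned} N(0)&=\{1,2,3,4,6,8,9,11\}, & N(1)&=\{0,2,4,6,7,8,9,10\}, & N(2)&=\{0,1,3,4,5,8,10,11\},\\ N(3)&=\{0,2,4,5,6,7,9,11\}, & N(4)&=\{0,1,2,3,5,7,9,10\}, & N(5)&=\{2,3,4,6,7,8,10,11\},\\ N(6)&=\{0,1,3,5,7,8,9,11\},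 & N(7)&=\{1,3,4,5,6,8,9,10\}, & N(8)&=\{0,1,2,5,6,7,10,11\},\\ N(9)&=\{0,1,3,4,6,7\}, & N(10)&=\{1,2,4,5,7,8\}, & N(11)&=\{0,2,3,5,6,8\}. \end{aligned}$$ **Proposition.** $T_{12}$ is a flag triangulation of $S^3$ with $\gamma_2(T_{12})=1$, and it is basic. Moreover $T_{10}\not\preceq T_{12}$. -/

import Mathlib

universe u

namespace AbstractSimplicialComplex

/-! Throughout, an abstract simplicial complex on a type `V` has all elements of `V` as vertices, and
the empty simplex is left implicit: `faces` consists of the nonempty simplices. -/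

/-- The geometric realization of a complex with finite vertex set, in barycentric coordinates: the
convex combinations of vertices whose support is contained in a simplex, with the topology induced
from `V → ℝ`. -/
def realization {V : Type*} [Fintype V] (K : AbstractSimplicialComplex V) : Set (V → ℝ) :=
  {x | (∀ v, 0 ≤ x v) ∧ ∑ v, x v = 1 ∧ ∃ s ∈ K.faces, ∀ v, x v ≠ 0 → v ∈ s}

/-- `K` is a triangulation of the sphere `S^n`: its realization is homeomorphic to the unit sphere
of the Euclidean space of dimension `n + 1`. -/
def TriangulatesSphere {V : Type*} [Fintype V] (K : AbstractSimplicialComplex V) (n : ℕ) : Prop :=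
  Nonempty (K.realization ≃ₜ Metric.sphere (0 : EuclideanSpace ℝ (Fin (n + 1))) 1)

/-- Flagness: every nonempty finite set of pairwise adjacent vertices is a simplex. -/
def IsFlag {V : Type*} [DecidableEq V] (K : AbstractSimplicialComplex V) : Prop :=
  ∀ s : Finset V, s.Nonempty → (∀ v ∈ s, ∀ w ∈ s, ({v, w} : Finset V) ∈ K.faces) → s ∈ K.faces

/-- The number `f_i` of `i`-dimensional simplices. -/
noncomputable def fNum {V : Type*} (K : AbstractSimplicialComplex V) (i : ℕ) : ℕ :=
  {s ∈ K.faces | s.card = i + 1}.ncard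

/-- `γ₂ = f₃ - 2 f₂ + 4 f₁ - 8 f₀ + 16`. -/
noncomputable def gammaTwo {V : Type*} (K : AbstractSimplicialComplex V) : ℤ :=
  (K.fNum 3 : ℤ) - 2 * K.fNum 2 + 4 * K.fNum 1 - 8 * K.fNum 0 + 16

/-- A vertex map is simplicial if the image of every simplex is a simplex. -/
def IsSimplicialMap {V W : Type*} [DecidableEq W] (K : AbstractSimplicialComplex V)
    (L : AbstractSimplicialComplex W) (f : V → W) : Prop :=
  ∀ s ∈ K.faces, s.image f ∈ L.faces

/-- Isomorphism of simplicial complexes. -/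
def Isomorphic {V W : Type*} (K : AbstractSimplicialComplex V)
    (L : AbstractSimplicialComplex W) : Prop :=
  ∃ e : V ≃ W, ∀ s : Finset V, s ∈ K.faces ↔ s.map e.toEmbedding ∈ L.faces

/-- Oriented simplicial `n`-chains with integer coefficients. The value `c w` is the coefficient of
the oriented simplex `[w 0, …, w n]`; it changes sign with the orientation, and it vanishes unless
`w` lists the distinct vertices of a simplex of `K`. -/
def IsChain {V : Type*} [DecidableEq V] (K : AbstractSimplicialComplex V) (n : ℕ)
    (c : (Fin (n + 1) → V) → ℤ) : Prop :=
  (∀ (w : Fin (n + 1) → V) (π : Equiv.Perm (Fin (n + 1))),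
    c (w ∘ π) = ((Equiv.Perm.sign π : ℤˣ) : ℤ) * c w) ∧
  ∀ w, c w ≠ 0 → Function.Injective w ∧ Finset.univ.image w ∈ K.faces

/-- The simplicial boundary. Since `∂[u, w₀, …, wₙ₋₁]` contains `[w₀, …, wₙ₋₁]` with coefficient
`1`, the coefficient of `[w]` in `∂c` is the sum over all vertices `u` of that of `[u, w]` in
`c`. -/
def boundary {V : Type*} [Fintype V] {n : ℕ} (c : (Fin (n + 1) → V) → ℤ) :
    (Fin n → V) → ℤ :=
  fun w => ∑ u, c (Fin.cons u w)

/-- The chain map `f_#` induced by a vertex map `f`, that is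
`[v₀, …, vₙ] ↦ [f v₀, …, f vₙ]` (which is `0` if two of the vertices `f vᵢ` coincide, because the
terms of the sum then cancel in pairs for an alternating `c`). -/
def pushforward {V W : Type*} [Fintype V] [DecidableEq W] (f : V → W) {n : ℕ}
    (c : (Fin (n + 1) → V) → ℤ) : (Fin (n + 1) → W) → ℤ :=
  fun w => ∑ v : Fin (n + 1) → V, if f ∘ v = w then c v else 0

/-- Simplicial `n`-cycles (for `n ≥ 1`). -/
def IsCycle {V : Type*} [Fintype V] [DecidableEq V] (K : AbstractSimplicialComplex V) (n : ℕ)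
    (c : (Fin (n + 1) → V) → ℤ) : Prop :=
  K.IsChain n c ∧ boundary c = 0

/-- A fundamental cycle of a triangulation of a closed connected orientable `n`-manifold, such as
`S^n`: a generator of the infinite cyclic group `H_n(K; ℤ)`. As `K` has dimension `n`, there are no
nonzero `n`-boundaries, so that `H_n(K; ℤ)` is the group of `n`-cycles. -/
def IsFundamentalCycle {V : Type*} [Fintype V] [DecidableEq V] (K : AbstractSimplicialComplex V)
    (n : ℕ) (z : (Fin (n + 1) → V) → ℤ) : Prop :=
  K.IsCycle n z ∧ z ≠ 0 ∧ ∀ c, K.IsCycle n c → ∃ k : ℤ, c = k • z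

/-- The map `f` from `K` to `L` has degree `d` for suitable orientations of `K` and `L`:
`f_* [K] = d [L]`. (Another choice of orientations changes `d` at most by its sign.) -/
def HasDegree {V W : Type*} [Fintype V] [DecidableEq V] [Fintype W] [DecidableEq W]
    (K : AbstractSimplicialComplex V) (L : AbstractSimplicialComplex W) (n : ℕ) (f : V → W)
    (d : ℤ) : Prop :=
  ∃ z z', K.IsFundamentalCycle n z ∧ L.IsFundamentalCycle n z' ∧ pushforward f z = d • z'

/-- `K` dominates `L` (both of them triangulations of `S^n`): there is a simplicial map from `K` to
`L` of nonzero degree. -/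
def Dominates {V W : Type*} [Fintype V] [DecidableEq V] [Fintype W] [DecidableEq W]
    (n : ℕ) (K : AbstractSimplicialComplex V) (L : AbstractSimplicialComplex W) : Prop :=
  ∃ f : V → W, K.IsSimplicialMap L f ∧ ∃ d : ℤ, d ≠ 0 ∧ K.HasDegree L n f d

/-- `K` is a flag triangulation of `S^3` with positive `γ₂`. -/
def IsPositiveFlagSphere {V : Type*} [Fintype V] [DecidableEq V]
    (K : AbstractSimplicialComplex V) : Prop :=
  K.IsFlag ∧ K.TriangulatesSphere 3 ∧ 0 < K.gammaTwo

/-- A flag triangulation of `S^3` with positive `γ₂` is basic if it does not dominate any other one,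
that is, any one not isomorphic to it. -/
def IsBasic {V : Type*} [Fintype V] [DecidableEq V] (K : AbstractSimplicialComplex V) : Prop :=
  K.IsPositiveFlagSphere ∧
  ∀ (W : Type u) [Fintype W] [DecidableEq W] (L : AbstractSimplicialComplex W),
    L.IsPositiveFlagSphere → Dominates 3 K L → K.Isomorphic L

/-- The flag complex with a given `1`-skeleton: its simplices are the nonempty finite cliques. -/
def flagComplex {V : Type*} (G : SimpleGraph V) : AbstractSimplicialComplex V where
  faces := {s | s.Nonempty ∧ G.IsClique (s : Set V)}
  isRelLowerSet_faces := fun _ hs =>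
    ⟨hs.1, fun _ hts ht => ⟨ht, hs.2.subset (Finset.coe_subset.mpr hts)⟩⟩
  singleton_mem := fun v => ⟨Finset.singleton_nonempty v, by simp⟩

/-- The join of two complexes, on the disjoint union of their vertex sets. The two parts of a
simplex are simplices, one of which may be empty. -/
def join {V W : Type*} (K : AbstractSimplicialComplex V) (L : AbstractSimplicialComplex W) :
    AbstractSimplicialComplex (V ⊕ W) where
  faces := {s | s.Nonempty ∧ (s.toLeft = ∅ ∨ s.toLeft ∈ K.faces) ∧
    (s.toRight = ∅ ∨ s.toRight ∈ L.faces)}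
  isRelLowerSet_faces := by
    intro s hs
    refine ⟨hs.1, fun t hts ht => ⟨ht, ?_, ?_⟩⟩
    · rcases Finset.eq_empty_or_nonempty t.toLeft with h | h
      · exact Or.inl h
      · have hsub : t.toLeft ⊆ s.toLeft := Finset.toLeft_subset_toLeft hts
        rcases hs.2.1 with h0 | h1
        · rw [h0] at hsub
          exact Or.inl (Finset.subset_empty.mp hsub)
        · exact Or.inr ((K.isRelLowerSet_faces h1).2 hsub h)
    · rcases Finset.eq_empty_or_nonempty t.toRight with h | h
      · exact Or.inl h
      · have hsub : t.toRight ⊆ s.toRight := Finset.toRight_subset_toRight hts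
        rcases hs.2.2 with h0 | h1
        · rw [h0] at hsub
          exact Or.inl (Finset.subset_empty.mp hsub)
        · exact Or.inr ((L.isRelLowerSet_faces h1).2 hsub h)
  singleton_mem := by
    rintro (v | w)
    · refine ⟨Finset.singleton_nonempty _, Or.inr ?_, Or.inl ?_⟩
      · have h : ({Sum.inl v} : Finset (V ⊕ W)).toLeft = {v} := by ext; simp
        rw [h]; exact K.singleton_mem v
      · ext; simp
    · refine ⟨Finset.singleton_nonempty _, Or.inl ?_, Or.inr ?_⟩
      · ext; simp
      · have h : ({Sum.inr w} : Finset (V ⊕ W)).toRight = {w} := by ext; simp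
        rw [h]; exact L.singleton_mem w

/-- The pentagon: the triangulation of `S^1` with five vertices. -/
def pentagon : AbstractSimplicialComplex (Fin 5) := flagComplex (SimpleGraph.cycleGraph 5)

/-- The triangulation `T₁₀`: the join of two pentagons. -/
def T10 : AbstractSimplicialComplex (Fin 5 ⊕ Fin 5) := pentagon.join pentagon

/-- The sets of neighbours of the vertices `0, …, 11` of `T₁₂`. -/
def T12Neighbors : Fin 12 → Finset (Fin 12) :=
  ![{1, 2, 3, 4, 6, 8, 9, 11},
    {0, 2, 4, 6, 7, 8, 9, 10},
    {0, 1, 3, 4, 5, 8, 10, 11},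
    {0, 2, 4, 5, 6, 7, 9, 11},
    {0, 1, 2, 3, 5, 7, 9, 10},
    {2, 3, 4, 6, 7, 8, 10, 11},
    {0, 1, 3, 5, 7, 8, 9, 11},
    {1, 3, 4, 5, 6, 8, 9, 10},
    {0, 1, 2, 5, 6, 7, 10, 11},
    {0, 1, 3, 4, 6, 7},
    {1, 2, 4, 5, 7, 8},
    {0, 2, 3, 5, 6, 8}]

/-- The `1`-skeleton of `T₁₂`. -/
def T12Graph : SimpleGraph (Fin 12) where
  Adj i j := j ∈ T12Neighbors i
  symm := ⟨by decide⟩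
  loopless := ⟨by decide⟩

/-- The triangulation `T₁₂`: the flag complex with the given `1`-skeleton. -/
def T12 : AbstractSimplicialComplex (Fin 12) := flagComplex T12Graph

end AbstractSimplicialComplex

namespace AbstractSimplicialComplex

/-! ### Boolean list operations with fast kernel evaluation -/

/-! `T12` is the boundary of an explicit simplicial 4-polytope: radial projection from the origin
identifies its realization with the sphere (`triangulatesSphere_of_polytope`). Counting cliques
gives the face numbers 12, 45, 66, 33, so γ₂ = 1.

Let `f` be a simplicial map of nonzero degree from `T12` to a flag 3-sphere `L` with γ₂ > 0. Every
simplex of `L` lies in the image of a simplex of `T12`, because a nonzero 3-cycle of a triangulated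
3-sphere involves every simplex (`exists_subset_of_isCycle`). Indeed, a simplex left out would put
the support of the cycle into a punctured sphere, hence into three-space, where 3-cycles vanish
(`eq_zero_of_embedding`). The latter is a Sperner-type argument. The cycle is subdivided finely and
pushed to the vertices of a lattice triangulation of three-space, which has no finite 3-cycles. The
preimage of a single lattice point is so small that its points share a vertex with positive
coordinate; sending the lattice point back to that vertex recovers the coefficients of the original
cycle.

Moreover `L` has at least nine vertices (`nine_le_card`): the vertices opposite to the facets of a
tetrahedron make at least eight, and with exactly eight `L` is the boundary of a cross-polytope, for
which γ₂ = 0.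

Thus `L` is determined by the partition of the twelve vertices into fibres: it is flag, and its
edges are the pairs of fibres joined by an edge of `T12`. Cliques of fibres must lift to cliques of
`T12`. An exhaustive search (`searchOK_t12Adj`) shows that partitions into nine to eleven classes
with this property have γ₂ ≤ 0. Hence `f` is injective and an isomorphism
(`injective_of_gammaTwo_pos`). `T10` is a flag sphere with γ₂ = 1 but only ten vertices, so it is
not dominated. -/

def bAnd (a b : Bool) : Bool := Bool.rec false b a

def bOr (a b : Bool) : Bool := Bool.rec b true a

def bAll {α : Type*} (p : α → Bool) (l : List α) : Bool :=
  List.rec true (fun a _ r => bAnd (p a) r) l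

def bAny {α : Type*} (p : α → Bool) (l : List α) : Bool :=
  List.rec false (fun a _ r => bOr (p a) r) l

def bFilter {α : Type*} (p : α → Bool) (l : List α) : List α :=
  List.rec [] (fun a _ r => Bool.rec r (a :: r) (p a)) l

theorem bAnd_eq_true {a b : Bool} : bAnd a b = true ↔ a = true ∧ b = true := by
  cases a <;> simp [bAnd]

theorem bOr_eq_true {a b : Bool} : bOr a b = true ↔ a = true ∨ b = true := by
  cases a <;> simp [bOr]

theorem bAll_eq_true {α : Type*} {p : α → Bool} {l : List α} :
    bAll p l = true ↔ ∀ x ∈ l, p x = true := by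
  induction l with
  | nil => simp [bAll]
  | cons a l ih =>
    have h : bAll p (a :: l) = bAnd (p a) (bAll p l) := rfl
    rw [h, bAnd_eq_true, ih]; simp

theorem bAny_eq_true {α : Type*} {p : α → Bool} {l : List α} :
    bAny p l = true ↔ ∃ x ∈ l, p x = true := by
  induction l with
  | nil => simp [bAny]
  | cons a l ih =>
    have h : bAny p (a :: l) = bOr (p a) (bAny p l) := rfl
    rw [h, bOr_eq_true, ih]; simp

theorem bFilter_cons {α : Type*} (p : α → Bool) (a : α) (l : List α) :
    bFilter p (a :: l) = if p a = true then a :: bFilter p l else bFilter p l := by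
  have h : bFilter p (a :: l) = Bool.rec (bFilter p l) (a :: bFilter p l) (p a) := rfl
  rw [h]; cases p a <;> simp

theorem bFilter_eq {α : Type*} (p : α → Bool) (l : List α) : bFilter p l = l.filter p := by
  induction l with
  | nil => rfl
  | cons a l ih => rw [bFilter_cons, ih, List.filter_cons]

/-! ### Counting cliques -/

/-- The number of `n`-element sublists of pairwise adjacent elements. -/
def cliqueCount {β : Type*} (adj : β → β → Bool) (n : ℕ) : List β → ℕ :=
  Nat.rec (fun _ => 1)
    (fun _ ih l => List.rec 0 (fun a l r => Nat.add r (ih (bFilter (adj a) l))) l) n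

theorem cliqueCount_zero {β : Type*} (adj : β → β → Bool) (l : List β) :
    cliqueCount adj 0 l = 1 := rfl

theorem cliqueCount_succ_nil {β : Type*} (adj : β → β → Bool) (n : ℕ) :
    cliqueCount adj (n + 1) [] = 0 := rfl

theorem cliqueCount_succ_cons {β : Type*} (adj : β → β → Bool) (n : ℕ) (a : β) (l : List β) :
    cliqueCount adj (n + 1) (a :: l) =
      cliqueCount adj (n + 1) l + cliqueCount adj n (l.filter (adj a)) := by
  rw [← bFilter_eq]; rfl

theorem cliqueCount_map {β γ : Type*} (adj : β → β → Bool) (g : γ → β) (n : ℕ) (l : List γ) :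
    cliqueCount adj n (l.map g) = cliqueCount (fun x y => adj (g x) (g y)) n l := by
  induction n generalizing l with
  | zero => rfl
  | succ n ihn =>
    induction l with
    | nil => rfl
    | cons a l ih =>
      rw [List.map_cons, cliqueCount_succ_cons, cliqueCount_succ_cons, ih, List.filter_map, ihn]
      rfl

/-- The list has no repetitions and each element is compared with later ones only, so the diagonal
of `adj` plays no role. -/
theorem cliqueCount_congr {β : Type*} {adj adj' : β → β → Bool} (n : ℕ) {l : List β}
    (hl : l.Nodup) (h : ∀ x ∈ l, ∀ y ∈ l, x ≠ y → adj x y = adj' x y) :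
    cliqueCount adj n l = cliqueCount adj' n l := by
  induction n generalizing l with
  | zero => rfl
  | succ n ihn =>
    induction l with
    | nil => rfl
    | cons a l ih =>
      rw [List.nodup_cons] at hl
      have hf : l.filter (adj a) = l.filter (adj' a) := by
        apply List.filter_congr
        intro x hx
        exact h a (by simp) x (by simp [hx]) (fun e => hl.1 (e ▸ hx))
      rw [cliqueCount_succ_cons, cliqueCount_succ_cons,
        ih hl.2 (fun x hx y hy => h x (by simp [hx]) y (by simp [hy])), hf,
        ihn (hl.2.filter _)]
      intro x hx y hy
      exact h x (by simp [List.mem_of_mem_filter hx]) y (by simp [List.mem_of_mem_filter hy])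

/-- Removing the head `a` turns the cliques through `a` into cliques with one element less among the
neighbours of `a`; the recursion adds their number to that of the cliques avoiding `a`. -/
theorem ncard_cliques {β : Type*} [DecidableEq β] {adj : β → β → Bool}
    (hadj : ∀ x y, adj x y = true → adj y x = true) (n : ℕ) {l : List β} (hl : l.Nodup) :
    {s : Finset β | (∀ x ∈ s, x ∈ l) ∧ s.card = n ∧
      ∀ x ∈ s, ∀ y ∈ s, x ≠ y → adj x y = true}.ncard = cliqueCount adj n l := by
  induction n generalizing l with
  | zero =>
    rw [cliqueCount_zero, Set.ncard_eq_one]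
    refine ⟨∅, ?_⟩
    ext s
    simp only [Set.mem_ofPred_eq, Set.mem_singleton_iff, Finset.card_eq_zero]
    constructor
    · exact fun h => h.2.1
    · rintro rfl; simp
  | succ n ihn =>
    induction l with
    | nil =>
      rw [cliqueCount_succ_nil]
      convert Set.ncard_empty (Finset β)
      ext s
      simp only [List.not_mem_nil, Set.mem_ofPred_eq, Set.mem_empty_iff_false, iff_false]
      rintro ⟨h1, h2, -⟩
      have : s = ∅ := Finset.eq_empty_of_forall_notMem fun x hx => h1 x hx
      simp [this] at h2
    | cons a l ih =>
      rw [List.nodup_cons] at hl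
      rw [cliqueCount_succ_cons, ← ih hl.2, ← ihn (hl.2.filter (adj a))]
      set A := {s : Finset β | (∀ x ∈ s, x ∈ l) ∧ s.card = n + 1 ∧
        ∀ x ∈ s, ∀ y ∈ s, x ≠ y → adj x y = true}
      set B := {s : Finset β | (∀ x ∈ s, x ∈ l.filter (adj a)) ∧ s.card = n ∧
        ∀ x ∈ s, ∀ y ∈ s, x ≠ y → adj x y = true}
      have hB : ∀ s ∈ B, a ∉ s := fun s hs has => hl.1 (List.mem_of_mem_filter (hs.1 a has))
      have hinj : Set.InjOn (insert a) B := by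
        intro s hs t ht hst
        rw [← Finset.erase_insert (hB s hs), ← Finset.erase_insert (hB t ht)]
        exact congrArg (fun u : Finset β => u.erase a) hst
      have hfin : ∀ (l : List β) (C : Set (Finset β)), (∀ s ∈ C, ∀ x ∈ s, x ∈ l) → C.Finite := by
        intro l C hC
        refine (l.toFinset.powerset.finite_toSet).subset ?_
        intro s hs
        simp only [Finset.coe_powerset, Set.mem_preimage, Set.mem_powerset_iff]
        intro x hx
        simpa using hC s hs x hx
      rw [← hinj.ncard_image, ← Set.ncard_union_eq _ (hfin l A fun s hs => hs.1)
        ((hfin (l.filter (adj a)) B fun s hs => hs.1).image _)]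
      · congr 1
        ext s
        simp only [Set.mem_ofPred_eq, Set.mem_union, Set.mem_image, A]
        constructor
        · rintro ⟨h1, h2, h3⟩
          by_cases has : a ∈ s
          · right
            refine ⟨s.erase a, ⟨?_, ?_, ?_⟩, Finset.insert_erase has⟩
            · intro x hx
              rw [Finset.mem_erase] at hx
              have := h1 x hx.2
              rw [List.mem_cons] at this
              rw [List.mem_filter]
              exact ⟨this.resolve_left hx.1, h3 a has x hx.2 hx.1.symm⟩
            · rw [Finset.card_erase_of_mem has, h2]; rfl
            · intro x hx y hy
              exact h3 x (Finset.mem_of_mem_erase hx) y (Finset.mem_of_mem_erase hy)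
          · left
            refine ⟨fun x hx => ?_, h2, h3⟩
            have := h1 x hx
            rw [List.mem_cons] at this
            exact this.resolve_left (fun e => has (e ▸ hx))
        · rintro (⟨h1, h2, h3⟩ | ⟨t, ht, rfl⟩)
          · exact ⟨fun x hx => List.mem_cons_of_mem _ (h1 x hx), h2, h3⟩
          · refine ⟨?_, ?_, ?_⟩
            · intro x hx
              rw [Finset.mem_insert] at hx
              rcases hx with rfl | hx
              · simp
              · exact List.mem_cons_of_mem _ (List.mem_of_mem_filter (ht.1 x hx))
            · rw [Finset.card_insert_of_notMem (hB t ht), ht.2.1]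
            · intro x hx y hy hxy
              rw [Finset.mem_insert] at hx hy
              rcases hx with rfl | hx <;> rcases hy with rfl | hy
              · exact absurd rfl hxy
              · exact (List.mem_filter.1 (ht.1 y hy)).2
              · exact hadj _ _ (List.mem_filter.1 (ht.1 x hx)).2
              · exact ht.2.2 x hx y hy hxy
      · rw [Set.disjoint_left]
        rintro s hs ⟨t, ht, rfl⟩
        exact hl.1 (hs.1 a (Finset.mem_insert_self a t))

theorem fNum_eq_cliqueCount {W : Type*} [DecidableEq W] {L : AbstractSimplicialComplex W}
    (hL : L.IsFlag) {adj : W → W → Bool}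
    (hadj : ∀ v w, v ≠ w → (adj v w = true ↔ ({v, w} : Finset W) ∈ L.faces))
    {l : List W} (hl : l.Nodup) (hmem : ∀ w, w ∈ l) (i : ℕ) :
    L.fNum i = cliqueCount adj (i + 1) l := by
  classical
  rw [cliqueCount_congr (adj' := fun v w => decide (({v, w} : Finset W) ∈ L.faces)) _ hl
    (fun x _ y _ hxy => by rw [Bool.eq_iff_iff, hadj x y hxy, decide_eq_true_iff]),
    ← ncard_cliques (fun x y h => by simpa [Finset.pair_comm] using h) _ hl, fNum]
  congr 1
  ext s
  simp only [Set.mem_ofPred_eq, decide_eq_true_eq]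
  constructor
  · rintro ⟨h1, h2⟩
    refine ⟨fun x _ => hmem x, h2, fun x hx y hy _ => ?_⟩
    exact (L.isRelLowerSet_faces h1).2 (show ({x, y} : Finset W) ≤ s by
      intro z hz
      rw [Finset.mem_insert, Finset.mem_singleton] at hz
      rcases hz with rfl | rfl <;> assumption) ⟨x, by simp⟩
  · rintro ⟨-, h2, h3⟩
    refine ⟨hL s (Finset.card_pos.1 (by omega)) ?_, h2⟩
    intro v hv w hw
    by_cases hvw : v = w
    · subst hvw; simpa using L.singleton_mem v
    · exact h3 v hv w hw hvw

/-! ### Exhaustive search for simplicial maps -/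

section Search

variable {α : Type*} (adj : α → α → Bool)

/-- Can one choose pairwise adjacent elements, adjacent to all elements of `vs`, from the lists in
`cs`, each of them enlarged by `extra`? -/
def hasTransversal (extra : List α) (cs : List (List α)) : List α → Bool :=
  List.rec (fun _ => true) (fun c _ r vs =>
    bOr (bAny (fun x => bAnd (bAll (adj x) vs) (r (x :: vs))) c)
        (bAny (fun x => bAnd (bAll (adj x) vs) (r (x :: vs))) extra)) cs

def touches (c d : List α) : Bool := bAny (fun x => bAny (adj x) d) c

/-- Do all cliques of at most `n` further classes from `cands` lift, together with `chosen`, and are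
there none with `n + 1` further classes? -/
def cliquesLift (extra : List α) (n : ℕ) : List (List α) → List (List α) → Bool :=
  Nat.rec (fun _ cands => List.rec true (fun _ _ _ => false) cands)
    (fun _ ih chosen cands =>
      List.rec true (fun c cs r =>
        bAnd (hasTransversal adj extra (c :: chosen) [])
          (bAnd (ih (c :: chosen) (bFilter (touches adj c) cs)) r)) cands) n

/-- The ways to put `b` into one of the classes of `l` or into a new one. -/
def insertions (b : α) (l : List (List α)) : List (List α × List (List α)) :=
  List.rec [([b], [])] (fun c cs r => (b :: c, cs) :: r.map fun x => (x.1, c :: x.2)) l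

/-- The test for a partition into classes: `γ₂ ≤ 0`, or there are `N` classes. -/
def leafOK (N : ℕ) (C : List (List α)) : Bool :=
  bOr (Nat.beq C.length N)
    -- γ₂ ≤ 0 with the negative terms moved to the other side, so that the test stays in ℕ.
    (Nat.ble (cliqueCount (touches adj) 4 C + 4 * cliqueCount (touches adj) 2 C + 16)
     (2 * cliqueCount (touches adj) 3 C + 8 * cliqueCount (touches adj) 1 C))

/-- The search through the partitions with at least `M` classes. -/
def searchOK (N M : ℕ) (todo : List α) : List (List α) → Bool :=
  List.rec (leafOK adj N) (fun b todo ih C =>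
    bAll (fun x =>
      -- There are now `x.2.length + 1` classes, and each remaining element adds at most one; a
      -- branch that cannot reach `M` is dropped. So is a branch on which the lifting test at the
      -- class of `b` fails.
      bOr (Nat.blt (Nat.add x.2.length (Nat.succ todo.length)) M)
       (Bool.rec true (ih (x.1 :: x.2))
         (cliquesLift adj todo 3 [x.1] (bFilter (touches adj x.1) x.2)))) (insertions b C)) todo

theorem mem_insertions_self (b : α) (l : List (List α)) : ([b], l) ∈ insertions b l := by
  induction l with
  | nil => exact List.mem_singleton.2 rfl
  | cons c l ih =>
    exact List.mem_cons_of_mem _ (List.mem_map.2 ⟨_, ih, rfl⟩)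

theorem mem_insertions_middle (b : α) (l₁ : List (List α)) (c : List α) (l₂ : List (List α)) :
    (b :: c, l₁ ++ l₂) ∈ insertions b (l₁ ++ c :: l₂) := by
  induction l₁ with
  | nil => exact List.mem_cons_self
  | cons d l ih =>
    exact List.mem_cons_of_mem _ (List.mem_map.2 ⟨_, ih, rfl⟩)

theorem touches_eq_true {c d : List α} :
    touches adj c d = true ↔ ∃ x ∈ c, ∃ y ∈ d, adj x y = true := by
  simp [touches, bAny_eq_true]

variable {adj} {W : Type*} {f : α → W} {vs : List α}

/-- `cls w` lists the elements of `vs` outside `todo` which `f` maps to `w`. -/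
def IsClassList (f : α → W) (vs todo : List α) (w : W) (c : List α) : Prop :=
  ∀ x, x ∈ c ↔ x ∈ vs ∧ x ∉ todo ∧ f x = w

/-- Soundness of the pruning: each vertex of a lift either sits in its class already or still waits
in `todo`, which is why every class may be enlarged by all of `todo`. -/
theorem hasTransversal_of_lift {todo : List α} {cls : W → List α} {ws : List W}
    (hcls : ∀ w ∈ ws, IsClassList f vs todo w (cls w)) {xs : List α}
    (hxs : List.Forall₂ (fun w x => x ∈ vs ∧ f x = w) ws xs)
    (hp : xs.Pairwise fun a b => adj b a = true) {ys : List α}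
    (hy : ∀ x ∈ xs, ∀ y ∈ ys, adj x y = true) :
    hasTransversal adj todo (ws.map cls) ys = true := by
  induction hxs generalizing ys with
  | nil => rfl
  | @cons w x ws xs hwx hxs ih =>
    rw [List.pairwise_cons] at hp
    have hrec : hasTransversal adj todo (ws.map cls) (x :: ys) = true := by
      refine ih (fun w' hw' => hcls w' (by simp [hw'])) hp.2 ?_
      intro x' hx' y hy'
      rw [List.mem_cons] at hy'
      rcases hy' with rfl | hy'
      · exact hp.1 x' hx'
      · exact hy x' (by simp [hx']) y hy'
    have hall : bAll (adj x) ys = true := bAll_eq_true.2 fun y hy' => hy x (by simp) y hy'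
    refine bOr_eq_true.2 ?_
    by_cases hx : x ∈ todo
    · exact Or.inr (bAny_eq_true.2 ⟨x, hx, bAnd_eq_true.2 ⟨hall, hrec⟩⟩)
    · refine Or.inl (bAny_eq_true.2 ⟨x, ?_, bAnd_eq_true.2 ⟨hall, hrec⟩⟩)
      exact (hcls w (by simp) x).2 ⟨hwx.1, hx, hwx.2⟩

theorem adj_of_touches {G : SimpleGraph W} {todo : List α}
    (hadj : ∀ x ∈ vs, ∀ y ∈ vs, adj x y = true → f x ≠ f y → G.Adj (f x) (f y))
    {w w' : W} {c c' : List α} (hc : IsClassList f vs todo w c)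
    (hc' : IsClassList f vs todo w' c') (hne : w ≠ w') (h : touches adj c c' = true) :
    G.Adj w w' := by
  obtain ⟨x, hx, y, hy, hxy⟩ := (touches_eq_true adj).1 h
  obtain ⟨hx1, -, rfl⟩ := (hc x).1 hx
  obtain ⟨hy1, -, rfl⟩ := (hc' y).1 hy
  exact hadj x hx1 y hy1 hxy hne

/-- Touching classes have adjacent values, so the cliques tested are cliques of `G`. These lift by
`hlift`, and `hlen` excludes a fifth member. -/
theorem cliquesLift_of_lift {G : SimpleGraph W} {todo : List α}
    (hadj : ∀ x ∈ vs, ∀ y ∈ vs, adj x y = true → f x ≠ f y → G.Adj (f x) (f y))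
    (hlift : ∀ ws : List W, ws.Pairwise G.Adj → ∃ xs,
      List.Forall₂ (fun w x => x ∈ vs ∧ f x = w) ws xs ∧ xs.Pairwise fun a b => adj b a = true)
    (hlen : ∀ ws : List W, ws.Pairwise G.Adj → ws.length ≤ 4) {cls : W → List α} (n : ℕ)
    {chosen cands : List W}
    (hcls : ∀ w ∈ chosen ++ cands, IsClassList f vs todo w (cls w))
    (hchosen : chosen.Pairwise G.Adj) (hcands : cands.Nodup)
    (hcc : ∀ c ∈ cands, ∀ d ∈ chosen, G.Adj c d) (hn : n + chosen.length = 4) :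
    cliquesLift adj todo n (chosen.map cls) (cands.map cls) = true := by
  induction n generalizing chosen cands with
  | zero =>
    cases cands with
    | nil => rfl
    | cons c cs =>
      have h : (c :: chosen).Pairwise G.Adj := List.pairwise_cons.2 ⟨hcc c (by simp), hchosen⟩
      have := hlen _ h
      rw [List.length_cons] at this
      omega
  | succ n ih =>
    induction cands with
    | nil => rfl
    | cons c cs ihc =>
      rw [List.nodup_cons] at hcands
      have h : (c :: chosen).Pairwise G.Adj := List.pairwise_cons.2 ⟨hcc c (by simp), hchosen⟩
      refine bAnd_eq_true.2 ⟨?_, bAnd_eq_true.2 ⟨?_, ?_⟩⟩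
      · obtain ⟨xs, hxs, hp⟩ := hlift _ h
        refine hasTransversal_of_lift (ws := c :: chosen) ?_ hxs hp (by simp)
        intro w hw
        exact hcls w (by simp at hw ⊢; tauto)
      · change cliquesLift adj todo n ((c :: chosen).map cls)
          (bFilter (touches adj (cls c)) (cs.map cls)) = true
        rw [bFilter_eq, List.filter_map]
        refine ih ?_ h (hcands.2.filter _) ?_ (by simp; omega)
        · intro w hw
          apply hcls
          simp only [List.cons_append, List.mem_cons, List.mem_append, List.mem_filter] at hw ⊢
          tauto
        · intro d hd e he
          rw [List.mem_filter] at hd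
          rw [List.mem_cons] at he
          rcases he with rfl | he
          · refine (adj_of_touches hadj (hcls _ (by simp)) (hcls d (by simp [hd.1])) ?_ hd.2).symm
            rintro rfl
            exact hcands.1 hd.1
          · exact hcc d (by simp [hd.1]) e he
      · refine ihc ?_ hcands.2 (fun d hd => hcc d (by simp [hd]))
        intro w hw
        apply hcls
        simp at hw ⊢
        tauto

/-- The fibres of `f` trace out one branch of the search. The lifts keep it from being pruned, so it
reaches a leaf, which must pass the test. -/
theorem leafOK_of_searchOK [DecidableEq W] {G : SimpleGraph W} {N M : ℕ}
    (hadj : ∀ x ∈ vs, ∀ y ∈ vs, adj x y = true → f x ≠ f y → G.Adj (f x) (f y))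
    (hlift : ∀ ws : List W, ws.Pairwise G.Adj → ∃ xs,
      List.Forall₂ (fun w x => x ∈ vs ∧ f x = w) ws xs ∧ xs.Pairwise fun a b => adj b a = true)
    (hlen : ∀ ws : List W, ws.Pairwise G.Adj → ws.length ≤ 4)
    (hM : ∀ ws : List W, (∀ x ∈ vs, f x ∈ ws) → M ≤ ws.length)
    {todo : List α} (htodo : todo.Nodup) (hsub : ∀ x ∈ todo, x ∈ vs) {ws : List W}
    {cls : W → List α} (hws : ws.Nodup) (hcls : ∀ w ∈ ws, IsClassList f vs todo w (cls w))
    (hmem : ∀ x ∈ vs, x ∉ todo → f x ∈ ws) (h : searchOK adj N M todo (ws.map cls) = true) :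
    ∃ (ws' : List W) (cls' : W → List α), ws'.Nodup ∧
      (∀ w ∈ ws', IsClassList f vs [] w (cls' w)) ∧ (∀ x ∈ vs, f x ∈ ws') ∧
      leafOK adj N (ws'.map cls') = true := by
  induction todo generalizing ws cls with
  | nil => exact ⟨ws, cls, hws, hcls, fun x hx => hmem x hx (by simp), h⟩
  | cons b todo ih =>
    rw [List.nodup_cons] at htodo
    have hb : b ∈ vs := hsub b (by simp)
    -- One step along the branch: `c` is the class of `f b` after `b` has joined it, and `us` lists
    -- the other values found so far.
    have key : ∀ (c : List α) (us : List W), (f b :: us).Nodup →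
        (c, us.map cls) ∈ insertions b (ws.map cls) → (∀ w ∈ us, w ∈ ws) →
        IsClassList f vs todo (f b) c → (∀ x ∈ vs, x ∉ todo → f x ∈ f b :: us) →
        ∃ (ws' : List W) (cls' : W → List α), ws'.Nodup ∧
          (∀ w ∈ ws', IsClassList f vs [] w (cls' w)) ∧ (∀ x ∈ vs, f x ∈ ws') ∧
          leafOK adj N (ws'.map cls') = true := by
      intro c us hnd hins hus hc hmem'
      have h1 := bAll_eq_true.1 h _ hins
      rw [bOr_eq_true] at h1
      simp only at h1
      have hnd' := List.nodup_cons.1 hnd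
      set cls' := Function.update cls (f b) c with hcls'
      have hmap : us.map cls = us.map cls' := by
        apply List.map_congr_left
        intro w hw
        rw [hcls', Function.update_of_ne]
        rintro rfl
        exact hnd'.1 hw
      have hself : cls' (f b) = c := by rw [hcls', Function.update_self]
      have hC : ∀ w ∈ f b :: us, IsClassList f vs todo w (cls' w) := by
        intro w hw
        rw [List.mem_cons] at hw
        by_cases hwb : w = f b
        · rw [hwb, hself]; exact hc
        · have hwus := hw.resolve_left hwb
          rw [hcls', Function.update_of_ne hwb]
          intro x
          rw [hcls w (hus w hwus) x, List.mem_cons, not_or]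
          constructor
          · rintro ⟨h1, h2, h3⟩; exact ⟨h1, h2.2, h3⟩
          · rintro ⟨h1, h2, h3⟩
            exact ⟨h1, ⟨fun e => hwb (by rw [← h3, e]), h2⟩, h3⟩
      rcases h1 with h1 | h1
      · exfalso
        have h2 := hM (f b :: us ++ todo.map f) (by
          intro x hx
          rw [List.mem_append]
          by_cases hxt : x ∈ todo
          · exact Or.inr (List.mem_map.2 ⟨x, hxt, rfl⟩)
          · exact Or.inl (hmem' x hx hxt))
        have h3 : us.length + (todo.length + 1) < M := by simpa using h1
        simp at h2
        omega
      · have h2 : cliquesLift adj todo 3 [c] (bFilter (touches adj c) (us.map cls)) = true := by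
          rw [hmap, bFilter_eq, List.filter_map]
          have := cliquesLift_of_lift (todo := todo) hadj hlift hlen (cls := cls') 3
            (chosen := [f b]) (cands := us.filter (touches adj c ∘ cls')) ?_ (by simp)
            (hnd'.2.filter _) ?_ rfl
          · rwa [List.map_cons, List.map_nil, hself] at this
          · intro w hw
            apply hC
            simp at hw ⊢
            tauto
          · intro d hd e he
            rw [List.mem_singleton] at he
            subst he
            rw [List.mem_filter] at hd
            refine (adj_of_touches hadj (hC _ (by simp)) (hC d (by simp [hd.1])) ?_ ?_).symm
            · rintro rfl
              exact hnd'.1 hd.1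
            · rw [hself]; exact hd.2
        rw [h2] at h1
        simp only at h1
        refine ih htodo.2 (fun x hx => hsub x (by simp [hx])) hnd hC hmem' ?_
        rw [List.map_cons, hself, ← hmap]
        exact h1
    by_cases hbw : f b ∈ ws
    · obtain ⟨l₁, l₂, rfl⟩ := List.append_of_mem hbw
      have hnd : (f b :: (l₁ ++ l₂)).Nodup := by
        rw [List.nodup_middle] at hws; exact hws
      refine key (b :: cls (f b)) (l₁ ++ l₂) hnd ?_ ?_ ?_ ?_
      · rw [List.map_append, List.map_append, List.map_cons]
        exact mem_insertions_middle b _ _ _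
      · intro w hw
        simp at hw ⊢
        tauto
      · intro x
        rw [List.mem_cons, hcls (f b) hbw x, List.mem_cons, not_or]
        constructor
        · rintro (rfl | ⟨h1, h2, h3⟩)
          · exact ⟨hb, htodo.1, rfl⟩
          · exact ⟨h1, h2.2, h3⟩
        · rintro ⟨h1, h2, h3⟩
          by_cases hxb : x = b
          · exact Or.inl hxb
          · exact Or.inr ⟨h1, ⟨hxb, h2⟩, h3⟩
      · intro x hx hxt
        by_cases hxb : x = b
        · simp [hxb]
        · have := hmem x hx (by simp [hxb, hxt])
          simp at this ⊢
          tauto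
    · refine key [b] ws (List.nodup_cons.2 ⟨hbw, hws⟩) (mem_insertions_self b _) (fun w hw => hw)
        ?_ ?_
      · intro x
        rw [List.mem_singleton]
        constructor
        · rintro rfl; exact ⟨hb, htodo.1, rfl⟩
        · rintro ⟨h1, h2, h3⟩
          by_contra hxb
          exact hbw (h3 ▸ hmem x h1 (by simp [hxb, h2]))
      · intro x hx hxt
        by_cases hxb : x = b
        · simp [hxb]
        · exact List.mem_cons_of_mem _ (hmem x hx (by simp [hxb, hxt]))

end Search

/-! ### Face numbers of `T12` and the search applied to it -/

/-- Adjacency in the `1`-skeleton of `T₁₂`, read off a single number. -/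
def t12Adj (i j : ℕ) : Bool :=
  -- Bit `12 i + j` of the number is the entry `(i, j)` of the adjacency matrix.
  Nat.beq (Nat.land (Nat.shiftRight 1987831296011725328012607457506894985124702
    (Nat.add (Nat.mul 12 i) j)) 1) 1

theorem t12Adj_iff : ∀ i j : Fin 12, t12Adj i j = true ↔ T12Graph.Adj i j := by
  change ∀ i j : Fin 12, t12Adj i j = true ↔ j ∈ T12Neighbors i
  decide +kernel

theorem isFlag_flagComplex {V : Type*} [DecidableEq V] (G : SimpleGraph V) :
    (flagComplex G).IsFlag := by
  intro s hs h
  refine ⟨hs, fun v hv w hw hvw => ?_⟩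
  exact (h v hv w hw).2 (by simp) (by simp) hvw

theorem pair_mem_flagComplex {V : Type*} [DecidableEq V] {G : SimpleGraph V} {v w : V}
    (h : v ≠ w) : ({v, w} : Finset V) ∈ (flagComplex G).faces ↔ G.Adj v w := by
  refine ⟨fun hs => hs.2 (by simp) (by simp) h, fun hG => ⟨⟨v, by simp⟩, ?_⟩⟩
  rw [Finset.coe_pair, SimpleGraph.isClique_pair]
  exact fun _ => hG

theorem card_le_of_fNum_eq_zero {V : Type*} [Fintype V] {K : AbstractSimplicialComplex V} {n : ℕ}
    (h : K.fNum n = 0) {s : Finset V} (hs : s ∈ K.faces) : s.card ≤ n := by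
  by_contra hcard
  obtain ⟨t, hts, ht⟩ := Finset.exists_subset_card_eq (show n + 1 ≤ s.card by omega)
  have hfin : {s ∈ K.faces | s.card = n + 1}.Finite := Set.toFinite _
  rw [fNum, Set.ncard_eq_zero hfin] at h
  have : t ∈ {s ∈ K.faces | s.card = n + 1} :=
    ⟨(K.isRelLowerSet_faces hs).2 hts (Finset.card_pos.1 (by omega)), ht⟩
  rw [h] at this
  exact this

theorem fNum_T12 (i : ℕ) :
    T12.fNum i = cliqueCount t12Adj (i + 1) [0, 1, 2, 3, 4, 5, 6, 7, 8, 9, 10, 11] := by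
  rw [fNum_eq_cliqueCount (L := T12) (isFlag_flagComplex _) (adj := fun i j : Fin 12 => t12Adj i j)
    (fun v w hvw => (t12Adj_iff v w).trans (pair_mem_flagComplex hvw).symm)
    (List.nodup_finRange 12) (List.mem_finRange), ← cliqueCount_map t12Adj Fin.val]
  rfl

theorem gammaTwo_T12 : T12.gammaTwo = 1 := by
  have h0 : T12.fNum 0 = 12 := by rw [fNum_T12]; decide +kernel
  have h1 : T12.fNum 1 = 45 := by rw [fNum_T12]; decide +kernel
  have h2 : T12.fNum 2 = 66 := by rw [fNum_T12]; decide +kernel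
  have h3 : T12.fNum 3 = 33 := by rw [fNum_T12]; decide +kernel
  rw [gammaTwo, h0, h1, h2, h3]; norm_num

theorem card_le_four_of_mem_T12 {s : Finset (Fin 12)} (hs : s ∈ T12.faces) : s.card ≤ 4 :=
  card_le_of_fNum_eq_zero (by rw [fNum_T12]; decide +kernel) hs

/-- The computational core: a partition into nine to eleven classes has a clique of classes that
cannot lift, or five pairwise touching classes, or γ₂ ≤ 0. -/
theorem searchOK_t12Adj :
    searchOK t12Adj 12 9 [0, 1, 2, 3, 4, 5, 6, 7, 8, 9, 10, 11] [] = true := by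
  decide +kernel

/-- The `1`-skeleton of a complex. -/
def skeleton {V : Type*} [DecidableEq V] (K : AbstractSimplicialComplex V) : SimpleGraph V where
  Adj v w := v ≠ w ∧ ({v, w} : Finset V) ∈ K.faces
  symm := ⟨fun v w h => ⟨h.1.symm, by rw [Finset.pair_comm]; exact h.2⟩⟩
  loopless := ⟨fun _ h => h.1 rfl⟩

theorem IsFlag.mem_faces_of_pairwise {V : Type*} [DecidableEq V] {K : AbstractSimplicialComplex V}
    (hK : K.IsFlag) {l : List V} (hl : l.Pairwise K.skeleton.Adj) (hne : l ≠ []) :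
    l.toFinset ∈ K.faces := by
  refine hK _ (by simpa using hne) ?_
  intro v hv w hw
  rw [List.mem_toFinset] at hv hw
  by_cases hvw : v = w
  · subst hvw; simpa using K.singleton_mem v
  · have : Std.Symm K.skeleton.Adj := K.skeleton.symm
    exact (hl.forall hv hw hvw).2

/-- A simplicial map from `T₁₂` that covers a flag complex with `γ₂ > 0` and at least nine vertices
is injective. -/
theorem injective_of_gammaTwo_pos {W : Type*} [Fintype W] [DecidableEq W]
    {L : AbstractSimplicialComplex W} (hL : L.IsFlag) {f : Fin 12 → W}
    (hf : T12.IsSimplicialMap L f) (hcov : ∀ s ∈ L.faces, ∃ t ∈ T12.faces, s ⊆ t.image f)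
    (hcard : 9 ≤ Fintype.card W) (hγ : 0 < L.gammaTwo) : Function.Injective f := by
  classical
  set vs : List ℕ := [0, 1, 2, 3, 4, 5, 6, 7, 8, 9, 10, 11] with hvs
  -- The search runs on natural numbers, so `f` is extended to ℕ modulo 12.
  set g : ℕ → W := fun n => f (Fin.ofNat 12 n) with hg
  have hvs_iff : ∀ x, x ∈ vs ↔ x < 12 := by
    intro x
    rw [show vs = List.range 12 from rfl, List.mem_range]
  have hgf : ∀ i : Fin 12, g i = f i := by
    intro i
    rw [hg]
    simp
  have hsurj : ∀ w, ∃ i : Fin 12, f i = w := by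
    intro w
    obtain ⟨t, -, h⟩ := hcov _ (L.singleton_mem w)
    have := h (Finset.mem_singleton_self w)
    rw [Finset.mem_image] at this
    obtain ⟨i, -, hi⟩ := this
    exact ⟨i, hi⟩
  -- A clique of `L` is a simplex by flagness, so it is covered by the image of a simplex `t`.
  -- Preimages chosen in `t` are distinct, hence pairwise adjacent.
  have hlift' : ∀ ws : List W, ws.Pairwise L.skeleton.Adj → ∃ xs : List (Fin 12),
      List.Forall₂ (fun w x => f x = w) ws xs ∧ xs.Pairwise T12Graph.Adj ∧ xs.length ≤ 4 := by
    intro ws hws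
    by_cases hne : ws = []
    · subst hne; exact ⟨[], List.Forall₂.nil, List.Pairwise.nil, by simp⟩
    obtain ⟨t, ht, hsub⟩ := hcov _ (hL.mem_faces_of_pairwise hws hne)
    have hex : ∀ w : W, ∃ i : Fin 12, w ∈ ws → i ∈ t ∧ f i = w := by
      intro w
      by_cases hw : w ∈ ws
      · have := hsub (List.mem_toFinset.2 hw)
        rw [Finset.mem_image] at this
        obtain ⟨i, h1, h2⟩ := this
        exact ⟨i, fun _ => ⟨h1, h2⟩⟩
      · exact ⟨0, fun h => absurd h hw⟩
    choose r hr using hex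
    have hnd : (ws.map r).Nodup := by
      refine List.Nodup.map_on ?_ (hws.imp fun h => h.ne)
      intro x hx y hy hxy
      rw [← (hr x hx).2, ← (hr y hy).2, hxy]
    refine ⟨ws.map r, ?_, ?_, ?_⟩
    · rw [List.forall₂_map_right_iff, List.forall₂_same]
      exact fun w hw => (hr w hw).2
    · refine List.Pairwise.imp_of_mem ?_ hnd
      intro a b ha hb hab
      rw [List.mem_map] at ha hb
      obtain ⟨v, hv, rfl⟩ := ha
      obtain ⟨w, hw, rfl⟩ := hb
      exact ht.2 (Finset.mem_coe.2 (hr v hv).1) (Finset.mem_coe.2 (hr w hw).1) hab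
    · rw [← List.toFinset_card_of_nodup hnd]
      refine (Finset.card_le_card ?_).trans (card_le_four_of_mem_T12 ht)
      intro x hx
      rw [List.mem_toFinset, List.mem_map] at hx
      obtain ⟨w, hw, rfl⟩ := hx
      exact (hr w hw).1
  have hadj : ∀ x ∈ vs, ∀ y ∈ vs, t12Adj x y = true → g x ≠ g y → L.skeleton.Adj (g x) (g y) := by
    intro x hx y hy hxy hne
    rw [hvs_iff] at hx hy
    refine ⟨hne, ?_⟩
    have h1 : T12Graph.Adj ⟨x, hx⟩ ⟨y, hy⟩ := (t12Adj_iff ⟨x, hx⟩ ⟨y, hy⟩).1 hxy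
    have h2 := hf _ ((pair_mem_flagComplex h1.ne).2 h1)
    rw [Finset.image_insert, Finset.image_singleton] at h2
    rw [← hgf, ← hgf] at h2
    exact h2
  have hlift : ∀ ws : List W, ws.Pairwise L.skeleton.Adj → ∃ xs,
      List.Forall₂ (fun w x => x ∈ vs ∧ g x = w) ws xs ∧
        xs.Pairwise fun a b => t12Adj b a = true := by
    intro ws hws
    obtain ⟨xs, h1, h2, -⟩ := hlift' ws hws
    refine ⟨xs.map Fin.val, ?_, ?_⟩
    · rw [List.forall₂_map_right_iff]
      refine h1.imp ?_
      intro w x hx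
      exact ⟨(hvs_iff _).2 x.2, by rw [hgf, hx]⟩
    · rw [List.pairwise_map]
      exact h2.imp fun h => (t12Adj_iff _ _).2 h.symm
  have hlen : ∀ ws : List W, ws.Pairwise L.skeleton.Adj → ws.length ≤ 4 := by
    intro ws hws
    obtain ⟨xs, h1, -, h3⟩ := hlift' ws hws
    rw [h1.length_eq]; exact h3
  have hall : ∀ ws : List W, (∀ x ∈ vs, g x ∈ ws) → ∀ w, w ∈ ws := by
    intro ws hws w
    obtain ⟨i, rfl⟩ := hsurj w
    rw [← hgf]
    exact hws i ((hvs_iff _).2 i.2)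
  obtain ⟨ws, cls, hnd, hcls, hmem, hleaf⟩ := leafOK_of_searchOK (N := 12) (M := 9) (f := g) (todo := vs)
    (ws := []) (cls := fun _ => []) hadj hlift hlen (by
      intro ws hws
      refine hcard.trans ?_
      rw [← Finset.card_univ]
      refine (Finset.card_le_card ?_).trans (List.toFinset_card_le ws)
      intro w _
      exact List.mem_toFinset.2 (hall ws hws w)) (by decide) (fun _ h => h) List.nodup_nil
    (by simp) (fun x hx hx' => absurd hx hx') searchOK_t12Adj
  have hws := hall ws hmem
  -- At the leaf two classes touch exactly when their values span an edge of `L`, so the tested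
  -- numbers are the face numbers of `L`.
  have hcount : ∀ i, L.fNum i = cliqueCount (touches t12Adj) (i + 1) (ws.map cls) := by
    intro i
    rw [cliqueCount_map]
    refine fNum_eq_cliqueCount hL ?_ hnd hws i
    intro v w hvw
    constructor
    · exact fun h => (adj_of_touches hadj (hcls v (hws v)) (hcls w (hws w)) hvw h).2
    · intro h
      obtain ⟨xs, h1, h2⟩ := hlift [w, v] (by
        rw [List.pairwise_pair]; exact ⟨hvw.symm, by rwa [Finset.pair_comm]⟩)
      cases h1 with
      | cons hx h1 =>
        cases h1 with
        | cons hy h1 =>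
          cases h1
          rw [List.pairwise_pair] at h2
          refine (touches_eq_true _).2 ⟨_, ?_, _, ?_, h2⟩
          · exact (hcls v (hws v) _).2 ⟨hy.1, by simp, hy.2⟩
          · exact (hcls w (hws w) _).2 ⟨hx.1, by simp, hx.2⟩
  rcases bOr_eq_true.1 hleaf with h | h
  · have h12 : ws.length = 12 := by
      rw [← List.length_map cls]; exact Nat.eq_of_beq_eq_true h
    have hcardW : Fintype.card W = 12 := by
      rw [← h12, ← List.toFinset_card_of_nodup hnd, ← Finset.card_univ]
      congr 1
      ext w
      simp [hws w]
    exact ((Fintype.bijective_iff_surjective_and_card f).2 ⟨hsurj, by simp [hcardW]⟩).1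
  · exfalso
    have h' := Nat.le_of_ble_eq_true h
    rw [gammaTwo, hcount, hcount, hcount, hcount] at hγ
    norm_num at hγ
    omega

/-! ### Ordered chains -/

/-- Formal integer combinations of finite sequences. -/
abbrev ListChain (E : Type*) := List E →₀ ℤ

namespace ListChain

variable {E F : Type*}

/-- A sequence as a chain. -/
noncomputable abbrev of (l : List E) : ListChain E := Finsupp.single l 1

theorem hom_ext {M : Type*} [AddCommGroup M] {f g : ListChain E →ₗ[ℤ] M}
    (h : ∀ l, f (of l) = g (of l)) : f = g :=
  Finsupp.lhom_ext' fun l => LinearMap.ext_ring (h l)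

/-- The linear extension of a function on sequences. -/
noncomputable def lift {M : Type*} [AddCommGroup M] (f : List E → M) : ListChain E →ₗ[ℤ] M :=
  Finsupp.linearCombination ℤ f

@[simp]
theorem lift_of {M : Type*} [AddCommGroup M] (f : List E → M) (l : List E) :
    lift f (of l) = f l := by
  simp [lift]

/-- The chains all of whose sequences satisfy `P`. -/
def supportedOn (P : List E → Prop) : Submodule ℤ (ListChain E) :=
  Finsupp.supported ℤ ℤ {l | P l}

theorem of_mem_supportedOn {P : List E → Prop} {l : List E} (h : P l) : of l ∈ supportedOn P :=
  Finsupp.single_mem_supported ℤ 1 h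

theorem map_mem_of_supportedOn {M : Type*} [AddCommGroup M] {P : List E → Prop}
    {f : ListChain E →ₗ[ℤ] M} {N : Submodule ℤ M} (h : ∀ l, P l → f (of l) ∈ N) {c : ListChain E}
    (hc : c ∈ supportedOn P) : f c ∈ N := by
  have hle : supportedOn P ≤ N.comap f := by
    rw [supportedOn, Finsupp.supported_eq_span_single, Submodule.span_le]
    rintro _ ⟨l, hl, rfl⟩
    exact h l hl
  exact hle hc

theorem map_eq_of_supportedOn {M : Type*} [AddCommGroup M] {P : List E → Prop}
    {f g : ListChain E →ₗ[ℤ] M} (h : ∀ l, P l → f (of l) = g (of l)) {c : ListChain E}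
    (hc : c ∈ supportedOn P) : f c = g c := by
  have := map_mem_of_supportedOn (f := f - g) (N := ⊥) (fun l hl => by simp [h l hl]) hc
  simpa [sub_eq_zero] using this

theorem supportedOn_mono {P Q : List E → Prop} (h : ∀ l, P l → Q l) :
    supportedOn P ≤ supportedOn Q :=
  Finsupp.supported_mono fun l hl => h l hl

/-- Prepending an element. -/
noncomputable def cone (a : E) : ListChain E →ₗ[ℤ] ListChain E := lift fun l => of (a :: l)

@[simp]
theorem cone_of (a : E) (l : List E) : cone a (of l) = of (a :: l) := lift_of _ _

/-- The boundary of a sequence, with the empty sequence as augmentation. -/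
noncomputable def bdList : List E → ListChain E
  | [] => 0
  | a :: l => of l - cone a (bdList l)

/-- The boundary operator. -/
noncomputable def bd : ListChain E →ₗ[ℤ] ListChain E := lift bdList

@[simp]
theorem bd_nil : bd (of ([] : List E)) = 0 := by rw [bd, lift_of, bdList]

theorem bd_cons (a : E) (l : List E) : bd (of (a :: l)) = of l - cone a (bd (of l)) := by
  simp only [bd, lift_of, bdList]

theorem bd_cone (a : E) (c : ListChain E) : bd (cone a c) = c - cone a (bd c) := by
  have : bd ∘ₗ cone a = LinearMap.id - cone a ∘ₗ bd :=
    hom_ext fun l => by simp [bd_cons]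
  exact LinearMap.congr_fun this c

theorem bd_bd (c : ListChain E) : bd (bd c) = 0 := by
  have : bd ∘ₗ bd = (0 : ListChain E →ₗ[ℤ] ListChain E) := by
    refine hom_ext fun l => ?_
    induction l with
    | nil => simp
    | cons a l ih =>
      simp only [LinearMap.comp_apply, LinearMap.zero_apply] at ih ⊢
      rw [bd_cons, map_sub, bd_cone, ih]; simp
  exact LinearMap.congr_fun this c

/-- The chain map induced by a function. -/
noncomputable def push (f : E → F) : ListChain E →ₗ[ℤ] ListChain F := lift fun l => of (l.map f)

@[simp]
theorem push_of (f : E → F) (l : List E) : push f (of l) = of (l.map f) := lift_of _ _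

theorem push_cone (f : E → F) (a : E) (c : ListChain E) :
    push f (cone a c) = cone (f a) (push f c) := by
  have : push f ∘ₗ cone a = cone (f a) ∘ₗ push f := hom_ext fun l => by simp
  exact LinearMap.congr_fun this c

theorem bd_push (f : E → F) (c : ListChain E) : bd (push f c) = push f (bd c) := by
  have : bd ∘ₗ push f = push f ∘ₗ bd := by
    refine hom_ext fun l => ?_
    induction l with
    | nil => simp
    | cons a l ih =>
      simp only [LinearMap.comp_apply, push_of, List.map_cons] at ih ⊢
      rw [bd_cons, bd_cons, map_sub, push_cone, ← ih, push_of]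
  exact LinearMap.congr_fun this c

theorem push_push {G : Type*} (f : E → F) (g : F → G) (c : ListChain E) :
    push g (push f c) = push (g ∘ f) c := by
  have : push g ∘ₗ push f = push (g ∘ f) := hom_ext fun l => by simp
  exact LinearMap.congr_fun this c

theorem bd_of_mem (l : List E) :
    bd (of l) ∈ supportedOn fun m => m.length + 1 = l.length ∧ ∀ x ∈ m, x ∈ l := by
  induction l with
  | nil => simp
  | cons a l ih =>
    rw [bd_cons]
    refine Submodule.sub_mem _ (of_mem_supportedOn ⟨by simp, fun x hx => by simp [hx]⟩) ?_
    refine map_mem_of_supportedOn ?_ ih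
    rintro m ⟨h1, h2⟩
    rw [cone_of]
    refine of_mem_supportedOn ⟨by simp [h1], ?_⟩
    intro x hx
    rw [List.mem_cons] at hx ⊢
    exact hx.imp id (h2 x)

theorem bd_ofFn {n : ℕ} (x : Fin (n + 1) → E) :
    bd (of (List.ofFn x)) = ∑ i : Fin (n + 1), (-1 : ℤ) ^ (i : ℕ) • of (List.ofFn (x ∘ i.succAbove)) := by
  induction n with
  | zero => simp [bd_cons]
  | succ n ih =>
    rw [List.ofFn_succ, bd_cons, ih, map_sum, Fin.sum_univ_succ (n := n + 1), sub_eq_add_neg,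
      ← Finset.sum_neg_distrib]
    congr 1
    · simp
    · refine Finset.sum_congr rfl fun i _ => ?_
      rw [map_zsmul, cone_of, List.ofFn_succ (f := x ∘ i.succ.succAbove)]
      simp only [Function.comp_apply, Fin.succ_succAbove_zero, Fin.succ_succAbove_succ,
        Fin.val_succ, pow_succ, mul_neg, mul_one, neg_smul]
      rfl

open Classical in
/-- The matrix recording which entries of `l` agree with which entries of `w`. -/
noncomputable def coincidence {n : ℕ} (x w : Fin n → E) : Matrix (Fin n) (Fin n) ℤ :=
  Matrix.of fun i j => if x i = w j then 1 else 0

open Classical in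
/-- The coefficient of the oriented simplex `w` in a chain. -/
noncomputable def coeff {n : ℕ} (w : Fin n → E) : ListChain E →ₗ[ℤ] ℤ :=
  -- The determinant is the sign of the rearrangement if `l` rearranges a sequence `w` without
  -- repetitions, and 0 otherwise.
  lift fun l => if h : l.length = n then (coincidence (fun i => l.get (i.cast h.symm)) w).det else 0

theorem coeff_ofFn {n : ℕ} (w x : Fin n → E) :
    coeff w (of (List.ofFn x)) = (coincidence x w).det := by
  rw [coeff, lift_of, dif_pos (List.length_ofFn)]
  congr
  ext i
  simp

theorem exists_ofFn {n : ℕ} {l : List E} (h : l.length = n) : ∃ x : Fin n → E, l = List.ofFn x := by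
  subst h
  exact ⟨l.get, (List.ofFn_get l).symm⟩

theorem coeff_comp_perm {n : ℕ} (w : Fin n → E) (π : Equiv.Perm (Fin n)) (c : ListChain E) :
    coeff (w ∘ π) c = (Equiv.Perm.sign π : ℤ) * coeff w c := by
  have : coeff (w ∘ π) = (Equiv.Perm.sign π : ℤ) • coeff w := by
    refine hom_ext fun l => ?_
    by_cases h : l.length = n
    · obtain ⟨x, rfl⟩ := exists_ofFn h
      rw [LinearMap.smul_apply, coeff_ofFn, coeff_ofFn, smul_eq_mul,
        show coincidence x (w ∘ π) = (coincidence x w).submatrix id π from rfl,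
        Matrix.det_permute', Int.cast_id]
    · simp [coeff, h]
  rw [this]; rfl

/-- If the coefficient of `w` in the sequence `l` is not zero, then `l` is a rearrangement of
`w`. -/
theorem of_coeff_ne_zero {n : ℕ} {w : Fin n → E} {l : List E} (h : coeff w (of l) ≠ 0) :
    Function.Injective w ∧ (∀ j, w j ∈ l) ∧ (∀ x ∈ l, x ∈ Set.range w) ∧ l.Nodup := by
  classical
  have hl : l.length = n := by
    by_contra hl
    simp [coeff, hl] at h
  obtain ⟨x, rfl⟩ := exists_ofFn hl
  rw [coeff_ofFn] at h
  refine ⟨?_, ?_, ?_, ?_⟩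
  · intro i j hij
    by_contra hne
    exact h (Matrix.det_zero_of_column_eq hne fun k => by simp [coincidence, hij])
  · intro j
    by_contra hj
    refine h (Matrix.det_eq_zero_of_column_eq_zero j fun i => ?_)
    simp only [coincidence, Matrix.of_apply, ite_eq_right_iff, one_ne_zero, imp_false]
    intro e
    exact hj (List.mem_ofFn.2 ⟨i, e⟩)
  · intro y hy
    obtain ⟨i, rfl⟩ := List.mem_ofFn.1 hy
    by_contra hi
    refine h (Matrix.det_eq_zero_of_row_eq_zero i fun j => ?_)
    simp only [coincidence, Matrix.of_apply, ite_eq_right_iff, one_ne_zero, imp_false]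
    intro e
    exact hi ⟨j, e.symm⟩
  · rw [List.nodup_ofFn]
    intro i j hij
    by_contra hne
    exact h (Matrix.det_zero_of_row_eq hne (by ext k; simp [coincidence, hij]))

/-- Laplace expansion of the coincidence determinant along its first column, which marks the entries
of `l` equal to `u`. -/
theorem coeff_bd {n : ℕ} (w : Fin n → E) {l : List E} (hl : l.length = n + 1) {S : Finset E}
    (hS : ∀ x ∈ l, x ∈ S) :
    coeff w (bd (of l)) = ∑ u ∈ S, coeff (Fin.cons u w : Fin (n + 1) → E) (of l) := by
  classical
  obtain ⟨x, rfl⟩ := exists_ofFn hl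
  rw [bd_ofFn, map_sum]
  have h : ∀ u, coeff (Fin.cons u w : Fin (n + 1) → E) (of (List.ofFn x)) =
      ∑ i : Fin (n + 1), (-1 : ℤ) ^ (i : ℕ) * (if x i = u then 1 else 0) *
        (coincidence (x ∘ i.succAbove) w).det := by
    intro u
    rw [coeff_ofFn, Matrix.det_succ_column_zero]
    refine Finset.sum_congr rfl fun i _ => ?_
    congr 1
  simp only [h]
  rw [Finset.sum_comm]
  refine Finset.sum_congr rfl fun i _ => ?_
  rw [map_zsmul, coeff_ofFn, ← Finset.sum_mul, ← Finset.mul_sum, Finset.sum_ite_eq,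
    if_pos (hS _ (List.mem_ofFn.2 ⟨i, rfl⟩)), mul_one, smul_eq_mul]

/-- The Leibniz formula: a product of coincidence indicators is the indicator of `x ∘ π = w`. -/
theorem coeff_ofFn_eq_sum {n : ℕ} (w x : Fin n → E) :
    coeff w (of (List.ofFn x)) =
      ∑ π : Equiv.Perm (Fin n), (Equiv.Perm.sign π : ℤ) *
        (open Classical in if x ∘ π = w then 1 else 0) := by
  classical
  rw [coeff_ofFn, Matrix.det_apply']
  refine Finset.sum_congr rfl fun π _ => ?_
  congr 1
  simp only [coincidence, Matrix.of_apply]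
  rw [Finset.prod_ite_zero]
  simp [funext_iff]

/-- A chain without coefficients is sent to one without coefficients by every map. -/
theorem coeff_push_eq_zero {n : ℕ} {c : ListChain E} (hc : c ∈ supportedOn fun l => l.length = n)
    (h : ∀ x : Fin n → E, coeff x c = 0) (f : E → F) (w : Fin n → F) :
    coeff w (push f c) = 0 := by
  classical
  set S : Finset E := c.support.biUnion List.toFinset with hS
  have hc' : c ∈ supportedOn fun l => l.length = n ∧ ∀ x ∈ l, x ∈ S := by
    intro l hl
    refine ⟨hc hl, fun x hx => ?_⟩
    rw [hS, Finset.mem_biUnion]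
    exact ⟨l, hl, by simpa using hx⟩
  -- Summing over all tuples `x` meets each sequence of the chain once in each of its `n!`
  -- orderings, and the two signs cancel; hence the factor.
  have key : (n.factorial : ℤ) • (coeff w ∘ₗ push f) c =
      (∑ x ∈ Fintype.piFinset fun _ : Fin n => S, coeff w (of (List.ofFn (f ∘ x))) • coeff x) c := by
    rw [← LinearMap.smul_apply]
    refine map_eq_of_supportedOn ?_ hc'
    rintro l ⟨hl, hlS⟩
    obtain ⟨y, rfl⟩ := exists_ofFn hl
    simp only [LinearMap.smul_apply, LinearMap.comp_apply, push_of, LinearMap.sum_apply,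
      smul_eq_mul, List.map_ofFn]
    simp only [coeff_ofFn_eq_sum _ y, Finset.mul_sum]
    rw [Finset.sum_comm]
    have hterm : ∀ π : Equiv.Perm (Fin n),
        (∑ x ∈ Fintype.piFinset fun _ : Fin n => S, coeff w (of (List.ofFn (f ∘ x))) *
          ((Equiv.Perm.sign π : ℤ) * if y ∘ π = x then 1 else 0)) =
        coeff w (of (List.ofFn (f ∘ y))) := by
      intro π
      rw [Finset.sum_eq_single (y ∘ π)]
      · rw [if_pos rfl, mul_one, coeff_ofFn, coeff_ofFn]
        have : coincidence (f ∘ y ∘ π) w = (coincidence (f ∘ y) w).submatrix π id := rfl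
        rw [this, Matrix.det_permute, mul_comm, ← mul_assoc]
        rcases Int.units_eq_one_or (Equiv.Perm.sign π) with h | h <;> simp [h]
      · intro x _ hx
        rw [if_neg (Ne.symm hx)]; simp
      · intro hx
        exfalso
        apply hx
        rw [Fintype.mem_piFinset]
        exact fun i => hlS _ (List.mem_ofFn.2 ⟨_, rfl⟩)
    rw [Finset.sum_congr rfl fun π _ => hterm π]
    simp [Finset.card_univ, Fintype.card_perm]
  rw [LinearMap.sum_apply, Finset.sum_eq_zero (fun x _ => by simp [h x])] at key
  simpa [Nat.factorial_ne_zero] using key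

/-- A chain map that carries each sequence to chains on its entries preserves coefficients. -/
theorem coeff_of_carried [Fintype E] {Φ : ListChain E →ₗ[ℤ] ListChain E} {N : ℕ}
    (hnil : Φ (of []) = of [])
    (hbd : ∀ l : List E, l.length ≤ N → bd (Φ (of l)) = Φ (bd (of l)))
    (hcar : ∀ l : List E, l.length ≤ N →
      Φ (of l) ∈ supportedOn fun m => m.length = l.length ∧ ∀ x ∈ m, x ∈ l)
    {n : ℕ} (hn : n ≤ N) {l : List E} (hl : l.length = n) (w : Fin n → E) :
    coeff w (Φ (of l)) = coeff w (of l) := by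
  classical
  induction n generalizing l with
  | zero => rw [List.length_eq_zero_iff.1 hl, hnil]
  | succ n ih =>
    have hzero : ∀ w' : Fin (n + 1) → E, (∃ j, w' j ∉ l) ∨ ¬ Function.Injective w' →
        ∀ m : List E, (m.length = l.length ∧ ∀ x ∈ m, x ∈ l) → coeff w' (of m) = 0 := by
      intro w' hw' m hm
      by_contra h
      obtain ⟨h1, h2, -⟩ := of_coeff_ne_zero h
      rcases hw' with ⟨j, hj⟩ | hw'
      · exact hj (hm.2 _ (h2 j))
      · exact hw' h1
    have hzero' : ∀ w' : Fin (n + 1) → E, (∃ j, w' j ∉ l) ∨ ¬ Function.Injective w' →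
        coeff w' (Φ (of l)) = 0 := by
      intro w' hw'
      exact map_eq_of_supportedOn (f := coeff w') (g := 0) (hzero w' hw') (hcar l (by omega))
    by_cases hw : (∃ j, w j ∉ l) ∨ ¬ Function.Injective w
    · rw [hzero w hw l ⟨rfl, fun _ h => h⟩, hzero' w hw]
    push Not at hw
    obtain ⟨hmem, hinj⟩ := hw
    have hrange : ∀ x ∈ l, x ∈ Set.range w := by
      have hsub : Finset.univ.image w ⊆ l.toFinset := by
        intro x hx
        rw [Finset.mem_image] at hx
        obtain ⟨j, -, rfl⟩ := hx
        exact List.mem_toFinset.2 (hmem j)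
      have := Finset.eq_of_subset_of_card_le hsub (by
        rw [Finset.card_image_of_injective _ hinj, Finset.card_univ, Fintype.card_fin, ← hl]
        exact List.toFinset_card_le l)
      intro x hx
      have hx' : x ∈ Finset.univ.image w := by rw [this]; exact List.mem_toFinset.2 hx
      simpa using hx'
    -- Coefficients can be read off boundaries: among tuples with entries in `l`, only `w 0`
    -- completes the face `t` to an injective one. As Φ commutes with `bd`, the claim for `w`
    -- follows from the claim for `t`.
    set t : Fin n → E := Fin.tail w with ht
    have hw' : w = Fin.cons (w 0) t := (Fin.cons_self_tail w).symm
    have hother : ∀ u, u ≠ w 0 →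
        (∃ j, (Fin.cons u t : Fin (n + 1) → E) j ∉ l) ∨
          ¬ Function.Injective (Fin.cons u t : Fin (n + 1) → E) := by
      intro u hu
      by_cases hul : u ∈ l
      · right
        obtain ⟨j, rfl⟩ := hrange u hul
        intro h
        obtain ⟨k, rfl⟩ := Fin.exists_succ_eq.2 (show j ≠ 0 from fun e => hu (by rw [e]))
        have h0 : (Fin.cons (w k.succ) t : Fin (n + 1) → E) 0 =
            (Fin.cons (w k.succ) t : Fin (n + 1) → E) k.succ := by
          rw [Fin.cons_zero, Fin.cons_succ]; rfl
        exact absurd (h h0) (Fin.succ_ne_zero k).symm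
      · exact Or.inl ⟨0, by simpa using hul⟩
    have h1 : coeff t (bd (of l)) = coeff w (of l) := by
      rw [coeff_bd t hl (S := Finset.univ) (fun x _ => Finset.mem_univ x),
        Finset.sum_eq_single (w 0), ← hw']
      · intro u _ hu
        exact hzero _ (hother u hu) l ⟨rfl, fun _ h => h⟩
      · simp
    have h2 : coeff t (bd (Φ (of l))) = coeff w (Φ (of l)) := by
      have : ∀ c ∈ supportedOn (fun m : List E => m.length = l.length ∧ ∀ x ∈ m, x ∈ l),
          (coeff t ∘ₗ bd) c = coeff w c := by
        intro c hc
        refine map_eq_of_supportedOn ?_ hc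
        intro m hm
        rw [LinearMap.comp_apply, coeff_bd t (hm.1.trans hl) (S := Finset.univ)
          (fun x _ => Finset.mem_univ x), Finset.sum_eq_single (w 0), ← hw']
        · intro u _ hu
          exact hzero _ (hother u hu) m hm
        · simp
      exact this _ (hcar l (by omega))
    rw [← h1, ← h2, hbd l (by omega)]
    refine map_eq_of_supportedOn (f := coeff t ∘ₗ Φ) (g := coeff t) ?_ (bd_of_mem l)
    intro m hm
    exact ih (by omega) (by omega) t

/-! ### Chain homotopies and small fillings -/

/-- The prism between two maps, on a sequence. -/
noncomputable def prismList (f g : E → F) : List E → ListChain F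
  | [] => 0
  | a :: l => of (f a :: g a :: l.map g) - cone (f a) (prismList f g l)

/-- The prism operator. -/
noncomputable def prism (f g : E → F) : ListChain E →ₗ[ℤ] ListChain F := lift (prismList f g)

theorem prism_cons (f g : E → F) (a : E) (l : List E) :
    prism f g (of (a :: l)) = of (f a :: g a :: l.map g) - cone (f a) (prism f g (of l)) := by
  simp only [prism, lift_of, prismList]

@[simp]
theorem prism_nil (f g : E → F) : prism f g (of []) = 0 := by
  rw [prism, lift_of, prismList]

theorem prism_cone (f g : E → F) (a : E) (c : ListChain E) :
    prism f g (cone a c) = cone (f a) (cone (g a) (push g c)) - cone (f a) (prism f g c) := by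
  have : prism f g ∘ₗ cone a = cone (f a) ∘ₗ cone (g a) ∘ₗ push g - cone (f a) ∘ₗ prism f g :=
    hom_ext fun l => by simp [prism_cons]
  exact LinearMap.congr_fun this c

theorem bd_prism (f g : E → F) (c : ListChain E) :
    bd (prism f g c) = push g c - push f c - prism f g (bd c) := by
  have : bd ∘ₗ prism f g = push g - push f - prism f g ∘ₗ bd := by
    refine hom_ext fun l => ?_
    induction l with
    | nil => simp
    | cons a l ih =>
      simp only [LinearMap.comp_apply, LinearMap.sub_apply] at ih ⊢
      rw [prism_cons, map_sub, bd_cons, bd_cone, ih, bd_cons, bd_cons, map_sub (prism f g), prism_cone,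
        ← push_of g l, bd_push, push_of, push_of, push_of, push_of]
      simp only [map_sub, cone_of, List.map_cons]
      abel
  exact LinearMap.congr_fun this c

theorem prism_of_mem (f g : E → F) (l : List E) :
    prism f g (of l) ∈ supportedOn fun m =>
      m.length = l.length + 1 ∧ ∀ x ∈ m, ∃ y ∈ l, x = f y ∨ x = g y := by
  induction l with
  | nil => simp
  | cons a l ih =>
    rw [prism_cons]
    refine Submodule.sub_mem _ (of_mem_supportedOn ⟨by simp, ?_⟩) (map_mem_of_supportedOn ?_ ih)
    · intro x hx
      simp only [List.mem_cons, List.mem_map] at hx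
      rcases hx with rfl | rfl | ⟨y, hy, rfl⟩
      · exact ⟨a, by simp, Or.inl rfl⟩
      · exact ⟨a, by simp, Or.inr rfl⟩
      · exact ⟨y, by simp [hy], Or.inr rfl⟩
    · rintro m ⟨h1, h2⟩
      rw [cone_of]
      refine of_mem_supportedOn ⟨by simp [h1], ?_⟩
      intro x hx
      rw [List.mem_cons] at hx
      rcases hx with rfl | hx
      · exact ⟨a, by simp, Or.inl rfl⟩
      · obtain ⟨y, hy, h⟩ := h2 x hx
        exact ⟨y, by simp [hy], h⟩

/-- Sequences of `n` points of `S` at mutual distance at most `r`. -/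
def IsSmall [PseudoMetricSpace E] (S : Set E) (n : ℕ) (r : ℝ) (l : List E) : Prop :=
  l.length = n ∧ (∀ x ∈ l, x ∈ S) ∧ ∀ x ∈ l, ∀ y ∈ l, dist x y ≤ r

/-- Small cycles in a bounded convex set bound. -/
theorem exists_filling [NormedAddCommGroup E] [NormedSpace ℝ E] {S : Set E} (hS : Convex ℝ S)
    {b : E} (hb : b ∈ S) (hdist : ∀ x ∈ S, ∀ y ∈ S, dist x y ≤ 1) {r δ : ℝ} (hr : 0 ≤ r)
    (hδ : 0 < δ) {n : ℕ} {c : ListChain E} (hc : c ∈ supportedOn (IsSmall S n r))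
    (hbd : bd c = 0) : ∃ d ∈ supportedOn (IsSmall S (n + 1) (r + δ)), bd d = c := by
  obtain ⟨K, hK⟩ := exists_nat_gt (1 / δ)
  have hK0 : (0 : ℝ) < K := lt_trans (by positivity) hK
  have hKδ : 1 / (K : ℝ) ≤ δ := by
    rw [div_le_iff₀ hK0]
    rw [div_lt_iff₀ hδ] at hK
    linarith
  -- `h j` moves a point the fraction `j / K` of the way to `b`; one step moves points of `S` by at
  -- most `1 / K ≤ δ`.
  set h : ℕ → E → E := fun j x => (1 - (j : ℝ) / K) • x + ((j : ℝ) / K) • b with hh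
  have h0 : h 0 = id := by ext x; simp [hh]
  have hKb : ∀ x, h K x = b := by intro x; simp [hh, div_self hK0.ne']
  have hmem : ∀ j ≤ K, ∀ x ∈ S, h j x ∈ S := by
    intro j hj x hx
    have hj' : (j : ℝ) / K ≤ 1 := by
      rw [div_le_one hK0]; exact_mod_cast hj
    exact hS hx hb (by linarith) (by positivity) (by ring)
  have hsame : ∀ j ≤ K, ∀ x y, dist x y ≤ r → dist (h j x) (h j y) ≤ r := by
    intro j hj x y hxy
    have hj' : (j : ℝ) / K ≤ 1 := by
      rw [div_le_one hK0]; exact_mod_cast hj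
    have hj0 : 0 ≤ (j : ℝ) / K := by positivity
    rw [dist_eq_norm] at hxy ⊢
    have : h j x - h j y = (1 - (j : ℝ) / K) • (x - y) := by
      simp only [hh]; rw [smul_sub]; abel
    rw [this, norm_smul, Real.norm_of_nonneg (by linarith)]
    calc (1 - (j : ℝ) / K) * ‖x - y‖ ≤ 1 * ‖x - y‖ := by gcongr; linarith
      _ ≤ r := by linarith
  have hstep : ∀ j x, x ∈ S → dist (h j x) (h (j + 1) x) ≤ δ := by
    intro j x hx
    have : h j x - h (j + 1) x = (1 / (K : ℝ)) • (x - b) := by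
      simp only [hh]
      push_cast
      rw [add_div, smul_sub, sub_smul, sub_smul, add_smul, add_smul]
      abel
    rw [dist_eq_norm, this, norm_smul, Real.norm_of_nonneg (by positivity), ← dist_eq_norm]
    calc 1 / (K : ℝ) * dist x b ≤ 1 / (K : ℝ) * 1 := by gcongr; exact hdist x hx b hb
      _ ≤ δ := by linarith
  have htele : ∀ j ≤ K, ∃ e ∈ supportedOn (IsSmall S (n + 1) (r + δ)),
      bd e = push (h j) c - c := by
    intro j
    induction j with
    | zero =>
      intro _
      refine ⟨0, Submodule.zero_mem _, ?_⟩
      have : push (h 0) c = c := by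
        rw [h0]
        have : push (id : E → E) = LinearMap.id := hom_ext fun l => by simp
        rw [this]; rfl
      rw [this]; simp
    | succ j ih =>
      intro hj
      obtain ⟨e, he, hbe⟩ := ih (by omega)
      -- The prism mixes points of two consecutive stages, so mutual distances grow from `r` to at
      -- most `r + δ`, independently of the number of steps.
      refine ⟨e + prism (h j) (h (j + 1)) c, Submodule.add_mem _ he ?_, ?_⟩
      · refine map_mem_of_supportedOn ?_ hc
        rintro l ⟨hl1, hl2, hl3⟩
        refine supportedOn_mono ?_ (prism_of_mem (h j) (h (j + 1)) l)
        rintro m ⟨hm1, hm2⟩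
        refine ⟨by rw [hm1, hl1], ?_, ?_⟩
        · intro x hx
          obtain ⟨y, hy, rfl | rfl⟩ := hm2 x hx
          · exact hmem j (by omega) y (hl2 y hy)
          · exact hmem (j + 1) hj y (hl2 y hy)
        · intro x hx x' hx'
          obtain ⟨y, hy, hxy⟩ := hm2 x hx
          obtain ⟨y', hy', hxy'⟩ := hm2 x' hx'
          have hd := hl3 y hy y' hy'
          rcases hxy with rfl | rfl <;> rcases hxy' with rfl | rfl
          · linarith [hsame j (by omega) _ _ hd]
          · linarith [hsame j (by omega) _ _ hd, hstep j y' (hl2 y' hy'),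
              dist_triangle (h j y) (h j y') (h (j + 1) y')]
          · linarith [hsame j (by omega) _ _ hd, hstep j y (hl2 y hy),
              dist_triangle (h (j + 1) y) (h j y) (h j y'), dist_comm (h j y) (h (j + 1) y)]
          · linarith [hsame (j + 1) hj _ _ hd]
      · rw [map_add, hbe, bd_prism, hbd, map_zero]
        abel
  obtain ⟨e, he, hbe⟩ := htele K le_rfl
  -- At stage `K` all entries equal `b`, and the cone with apex `b` fills that constant cycle;
  -- subtracting the homotopy `e` leaves the boundary `c`.
  refine ⟨cone b (push (h K) c) - e, Submodule.sub_mem _ ?_ he, ?_⟩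
  · refine map_mem_of_supportedOn (f := cone b ∘ₗ push (h K)) ?_ hc
    rintro l ⟨hl1, hl2, hl3⟩
    rw [LinearMap.comp_apply, push_of, cone_of]
    have hall : ∀ x ∈ b :: l.map (h K), x = b := by
      intro x hx
      simp only [List.mem_cons, List.mem_map] at hx
      rcases hx with rfl | ⟨y, -, rfl⟩
      · rfl
      · exact hKb y
    refine of_mem_supportedOn ⟨by simp [hl1], fun x hx => by rw [hall x hx]; exact hb, ?_⟩
    intro x hx y hy
    rw [hall x hx, hall y hy, dist_self]
    linarith
  · rw [map_sub, hbe, bd_cone, bd_push, hbd]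
    simp

/-! ### Subdivision of simplices -/

/-- The points of the standard simplex whose support consists of entries of `l`. -/
def simplexOn {V : Type*} [Fintype V] (l : List V) : Set (V → ℝ) :=
  {x | (∀ v, 0 ≤ x v) ∧ ∑ v, x v = 1 ∧ ∀ v, x v ≠ 0 → v ∈ l}

theorem convex_simplexOn {V : Type*} [Fintype V] (l : List V) : Convex ℝ (simplexOn l) := by
  rintro x ⟨hx1, hx2, hx3⟩ y ⟨hy1, hy2, hy3⟩ a b ha hb hab
  refine ⟨fun v => ?_, ?_, fun v hv => ?_⟩
  · have := hx1 v
    have := hy1 v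
    simp only [Pi.add_apply, Pi.smul_apply, smul_eq_mul]
    positivity
  · simp only [Pi.add_apply, Pi.smul_apply, smul_eq_mul]
    rw [Finset.sum_add_distrib, ← Finset.mul_sum, ← Finset.mul_sum, hx2, hy2]
    linarith
  · by_contra hvl
    have h1 : x v = 0 := by by_contra h; exact hvl (hx3 v h)
    have h2 : y v = 0 := by by_contra h; exact hvl (hy3 v h)
    exact hv (by simp [h1, h2])

theorem dist_le_one_of_simplex {V : Type*} [Fintype V] {x y : V → ℝ} (hx : ∀ v, 0 ≤ x v)
    (hx' : ∑ v, x v = 1) (hy : ∀ v, 0 ≤ y v) (hy' : ∑ v, y v = 1) : dist x y ≤ 1 := by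
  rw [dist_pi_le_iff zero_le_one]
  intro v
  have h1 : x v ≤ 1 := hx' ▸ Finset.single_le_sum (fun w _ => hx w) (Finset.mem_univ v)
  have h2 : y v ≤ 1 := hy' ▸ Finset.single_le_sum (fun w _ => hy w) (Finset.mem_univ v)
  rw [Real.dist_eq, abs_le]
  constructor <;> linarith [hx v, hy v]

/-- Sequences of vertices can be subdivided into chains of small sequences of points. -/
theorem exists_subdivision (V : Type*) [Fintype V] {δ : ℝ} (hδ : 0 < δ) (N : ℕ) :
    ∃ Sd : ListChain V →ₗ[ℤ] ListChain (V → ℝ), Sd (of []) = of [] ∧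
      ∀ l : List V, l.length ≤ N → bd (Sd (of l)) = Sd (bd (of l)) ∧
        Sd (of l) ∈ supportedOn (IsSmall (simplexOn l) l.length (l.length * δ)) := by
  classical
  induction N with
  | zero =>
    refine ⟨lift fun l => if l = [] then of [] else 0, by simp, ?_⟩
    intro l hl
    obtain rfl : l = [] := List.length_eq_zero_iff.1 (by omega)
    refine ⟨by simp, ?_⟩
    rw [lift_of, if_pos rfl]
    exact of_mem_supportedOn ⟨rfl, by simp, by simp⟩
  | succ N ih =>
    obtain ⟨Sd, hnil, hSd⟩ := ih
    have hex : ∀ l : List V, ∃ d : ListChain (V → ℝ), l.length = N + 1 →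
        bd d = Sd (bd (of l)) ∧
          d ∈ supportedOn (IsSmall (simplexOn l) (N + 1) ((N + 1 : ℕ) * δ)) := by
      intro l
      by_cases hl : l.length = N + 1
      · obtain ⟨a, l', rfl⟩ := List.exists_cons_of_length_eq_add_one hl
        have hb : (Pi.single a 1 : V → ℝ) ∈ simplexOn (a :: l') := by
          refine ⟨fun v => ?_, by simp, fun v hv => ?_⟩
          · by_cases h : v = a
            · subst h; simp
            · simp [h]
          · by_contra h
            rw [List.mem_cons, not_or] at h
            exact hv (Pi.single_eq_of_ne h.1 _)
        have hmem : Sd (bd (of (a :: l'))) ∈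
            supportedOn (IsSmall (simplexOn (a :: l')) N (N * δ)) := by
          refine map_mem_of_supportedOn ?_ (bd_of_mem (a :: l'))
          rintro m ⟨hm1, hm2⟩
          have hmN : m.length = N := by omega
          refine supportedOn_mono ?_ (hSd m (by omega)).2
          rintro k ⟨hk1, hk2, hk3⟩
          refine ⟨by omega, fun x hx => ?_, by rw [hmN] at hk3; exact hk3⟩
          obtain ⟨h1, h2, h3⟩ := hk2 x hx
          exact ⟨h1, h2, fun v hv => hm2 v (h3 v hv)⟩
        have hcyc : bd (Sd (bd (of (a :: l')))) = 0 := by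
          have : bd (Sd (bd (of (a :: l')))) = Sd (bd (bd (of (a :: l')))) := by
            refine map_eq_of_supportedOn (f := bd ∘ₗ Sd) (g := Sd ∘ₗ bd) ?_ (bd_of_mem (a :: l'))
            rintro m ⟨hm1, -⟩
            exact (hSd m (by omega)).1
          rw [this, bd_bd, map_zero]
        -- The subdivided boundary is a cycle in the convex set carried by the simplex. Filling it
        -- there costs one more `δ`, whence the bound by length times `δ`.
        obtain ⟨d, hd, hbd⟩ := exists_filling (convex_simplexOn (a :: l')) hb
          (fun x hx y hy => dist_le_one_of_simplex hx.1 hx.2.1 hy.1 hy.2.1)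
          (by positivity) hδ hmem hcyc
        refine ⟨d, fun _ => ⟨hbd, ?_⟩⟩
        have : ((N + 1 : ℕ) : ℝ) * δ = N * δ + δ := by push_cast; ring
        rw [this]; exact hd
      · exact ⟨0, fun h => absurd h hl⟩
    choose fill hfill using hex
    set Sd' : ListChain V →ₗ[ℤ] ListChain (V → ℝ) :=
      lift fun l => if l.length = N + 1 then fill l else Sd (of l) with hSd'
    have hold : ∀ l : List V, l.length ≤ N → Sd' (of l) = Sd (of l) := by
      intro l hl
      rw [hSd', lift_of, if_neg (by omega)]
    have hnew : ∀ l : List V, l.length = N + 1 → Sd' (of l) = fill l := by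
      intro l hl
      rw [hSd', lift_of, if_pos hl]
    have hbdold : ∀ l : List V, l.length ≤ N + 1 → Sd' (bd (of l)) = Sd (bd (of l)) := by
      intro l hl
      refine map_eq_of_supportedOn ?_ (bd_of_mem l)
      rintro m ⟨hm, -⟩
      exact hold m (by omega)
    refine ⟨Sd', by rw [hold _ (by simp), hnil], fun l hl => ?_⟩
    rw [hbdold l hl]
    by_cases h : l.length = N + 1
    · rw [hnew l h, h]
      exact hfill l h
    · rw [hold l (by omega)]
      exact hSd l (by omega)

end ListChain

/-! ### A triangulation of three-space on the integer lattice -/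

namespace Lattice

open ListChain

/-- The sum of the coordinates of a lattice point. -/
def height (p : Fin 3 → ℤ) : ℤ := p 0 + p 1 + p 2

/-- Adjacency (or equality) in the Freudenthal triangulation. -/
def IsClose (p q : Fin 3 → ℤ) : Prop := (p ≤ q ∧ q ≤ p + 1) ∨ (q ≤ p ∧ p ≤ q + 1)

theorem le_iff {p q : Fin 3 → ℤ} : p ≤ q ↔ p 0 ≤ q 0 ∧ p 1 ≤ q 1 ∧ p 2 ≤ q 2 := by
  rw [Pi.le_def, Fin.forall_fin_succ, Fin.forall_fin_succ, Fin.forall_fin_one]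
  rfl

theorem height_mono {p q : Fin 3 → ℤ} (h : p ≤ q) : height p ≤ height q := by
  rw [le_iff] at h
  unfold height
  omega

theorem eq_of_le_of_height {p q : Fin 3 → ℤ} (h : p ≤ q) (h' : height q ≤ height p) : p = q := by
  rw [le_iff] at h
  unfold height at h'
  ext i
  fin_cases i <;> simp <;> omega

theorem height_add_one (p : Fin 3 → ℤ) : height (p + 1) = height p + 3 := by
  simp only [height, Pi.add_apply, Pi.one_apply]
  ring

theorem IsClose.le_of_height_lt {p q : Fin 3 → ℤ} (h : IsClose p q) (hh : height p < height q) :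
    p ≤ q ∧ q ≤ p + 1 := by
  rcases h with h | h
  · exact h
  · exact absurd (height_mono h.1) (not_le.2 hh)

theorem IsClose.symm {p q : Fin 3 → ℤ} (h : IsClose p q) : IsClose q p := Or.symm h

theorem IsClose.eq_of_height_eq {p q : Fin 3 → ℤ} (h : IsClose p q) (hh : height p = height q) :
    p = q := by
  rcases h with h | h
  · exact eq_of_le_of_height h.1 hh.ge
  · exact (eq_of_le_of_height h.1 hh.le).symm

/-- Sequences of pairwise adjacent lattice points. -/
def IsCell (n : ℕ) (l : List (Fin 3 → ℤ)) : Prop :=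
  l.length = n ∧ ∀ p ∈ l, ∀ q ∈ l, IsClose p q

variable {c : ListChain (Fin 3 → ℤ)}

/-- The triangle of the three points after `σ k` lies in only two tetrahedra, completed by `σ k` or
by `σ (k + 4)`. Since `bd c` vanishes on it, their coefficients agree up to sign. -/
theorem coeff_shift {σ : ℕ → Fin 3 → ℤ} (hh : ∀ k, height (σ (k + 1)) = height (σ k) + 1)
    (h3 : ∀ k, σ (k + 3) = σ k + 1) (hc : c ∈ supportedOn (IsCell 4)) (hbd : bd c = 0) (k : ℕ)
    (hk : coeff (fun i : Fin 4 => σ (k + i)) c ≠ 0) :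
    coeff (fun i : Fin 4 => σ (k + 1 + i)) c ≠ 0 := by
  classical
  set τ : Fin 3 → Fin 3 → ℤ := fun i => σ (k + 1 + i) with hτ
  have hh4 : height (σ (k + 4)) = height (σ k) + 4 := by
    have h1 := hh k
    have h2 := hh (k + 1)
    have h3 := hh (k + 2)
    have h4 := hh (k + 3)
    simp only [add_assoc, Nat.reduceAdd] at h1 h2 h3 h4
    omega
  have hne : σ k ≠ σ (k + 4) := fun e => by rw [← e] at hh4; omega
  have key : (coeff τ ∘ₗ bd) c = (coeff (Fin.cons (σ k) τ : Fin 4 → Fin 3 → ℤ) +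
      coeff (Fin.cons (σ (k + 4)) τ : Fin 4 → Fin 3 → ℤ)) c := by
    refine map_eq_of_supportedOn ?_ hc
    rintro l ⟨hl1, hl2⟩
    rw [LinearMap.comp_apply, coeff_bd τ hl1 (S := insert (σ k) (insert (σ (k + 4)) l.toFinset))
      (fun x hx => by simp [hx]), LinearMap.add_apply,
      ← Finset.sum_pair (f := fun u => coeff (Fin.cons u τ : Fin 4 → Fin 3 → ℤ) (of l)) hne]
    symm
    refine Finset.sum_subset ?_ ?_
    · intro u hu
      simp only [Finset.mem_insert, Finset.mem_singleton] at hu ⊢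
      tauto
    · intro u _ hu
      by_contra hcoeff
      obtain ⟨hinj, hmem, -⟩ := of_coeff_ne_zero hcoeff
      have hul : u ∈ l := by simpa using hmem 0
      have hcl : ∀ i : Fin 3, IsClose u (σ (k + 1 + i)) := by
        intro i
        refine hl2 u hul _ ?_
        have := hmem i.succ
        rwa [Fin.cons_succ] at this
      have hnu : ∀ i : Fin 3, u ≠ σ (k + 1 + i) := by
        intro i e
        have : (Fin.cons u τ : Fin 4 → Fin 3 → ℤ) 0 = (Fin.cons u τ : Fin 4 → Fin 3 → ℤ) i.succ := by
          rw [Fin.cons_zero, Fin.cons_succ]; exact e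
        exact absurd (hinj this) (Fin.succ_ne_zero i).symm
      have c0 := hcl 0
      have c1 := hcl 1
      have c2 := hcl 2
      have n0 := hnu 0
      have n1 := hnu 1
      have n2 := hnu 2
      simp only [Fin.val_zero, Fin.val_one, Fin.val_two, add_zero, add_assoc, Nat.reduceAdd] at c0 c1 c2 n0 n1 n2
      have g1 := hh k
      have g2 := hh (k + 1)
      have g3 := hh (k + 2)
      simp only [add_assoc, Nat.reduceAdd] at g1 g2 g3
      have m0 : height u ≠ height (σ (k + 1)) := fun e => n0 (c0.eq_of_height_eq e)
      have m1 : height u ≠ height (σ (k + 2)) := fun e => n1 (c1.eq_of_height_eq e)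
      have m2 : height u ≠ height (σ (k + 3)) := fun e => n2 (c2.eq_of_height_eq e)
      apply hu
      rw [Finset.mem_insert, Finset.mem_singleton]
      -- Adjacent points of equal height coincide, so `u` lies strictly below or strictly above the
      -- triangle; periodicity then pins it down to `σ k` or `σ (k + 4)`.
      rcases lt_or_ge (height u) (height (σ (k + 1))) with hlt | hge
      · left
        have h1 := (c2.le_of_height_lt (by omega)).2
        rw [h3 k] at h1
        have h2 := eq_of_le_of_height h1 (by rw [height_add_one, height_add_one]; omega)
        exact (add_right_cancel h2).symm
      · right
        have h1 := (c0.symm.le_of_height_lt (by omega)).2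
        rw [← h3 (k + 1)] at h1
        simp only [add_assoc, Nat.reduceAdd] at h1
        exact eq_of_le_of_height h1 (by omega)
  rw [LinearMap.comp_apply, hbd, map_zero, LinearMap.add_apply] at key
  have e1 : (Fin.cons (σ k) τ : Fin 4 → Fin 3 → ℤ) = fun i : Fin 4 => σ (k + i) := by
    ext1 i
    refine Fin.cases ?_ (fun i => ?_) i
    · simp
    · rw [Fin.cons_succ, hτ]
      simp only [Fin.val_succ]
      congr 1
      ring
  -- Moving the last vertex to the front costs only a sign.
  have e2 : (Fin.cons (σ (k + 4)) τ : Fin 4 → Fin 3 → ℤ) =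
      (fun i : Fin 4 => σ (k + 1 + i)) ∘ (finRotate 4).symm := by
    ext1 i
    fin_cases i <;> rfl
  rw [e1, e2, coeff_comp_perm] at key
  intro h
  rw [h, mul_zero, add_zero] at key
  exact hk key.symm

/-- A nonzero coefficient would propagate along the infinite staircase, while a chain involves
finitely many points. -/
theorem coeff_staircase_eq_zero {σ : ℕ → Fin 3 → ℤ}
    (hh : ∀ k, height (σ (k + 1)) = height (σ k) + 1) (h3 : ∀ k, σ (k + 3) = σ k + 1)
    (hc : c ∈ supportedOn (IsCell 4)) (hbd : bd c = 0) :
    coeff (fun i : Fin 4 => σ i) c = 0 := by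
  classical
  by_contra hne
  have hall : ∀ k, coeff (fun i : Fin 4 => σ (k + i)) c ≠ 0 := by
    intro k
    induction k with
    | zero => simpa using hne
    | succ k ih => exact coeff_shift hh h3 hc hbd k ih
  have hheight : ∀ k : ℕ, height (σ k) = height (σ 0) + k := by
    intro k
    induction k with
    | zero => simp
    | succ k ih => rw [hh, ih]; push_cast; ring
  set S := c.support.biUnion List.toFinset with hS
  have hmem : ∀ k, σ k ∈ S := by
    intro k
    by_contra hk
    apply hall k
    refine map_eq_of_supportedOn (P := fun l => ∀ x ∈ l, x ∈ S)
      (f := coeff fun i : Fin 4 => σ (k + i)) (g := 0) ?_ ?_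
    · intro l hl
      by_contra h
      obtain ⟨-, h2, -⟩ := of_coeff_ne_zero h
      exact hk (hl _ (by simpa using h2 0))
    · intro l hl x hx
      rw [hS, Finset.mem_biUnion]
      exact ⟨l, hl, by simpa using hx⟩
  have hinj : Function.Injective σ := by
    intro i j hij
    have h1 := hheight i
    have h2 := hheight j
    rw [hij, h2] at h1
    omega
  exact Set.infinite_range_of_injective hinj
    (S.finite_toSet.subset (by rintro _ ⟨k, rfl⟩; exact hmem k))

/-- The triangulation of three-space has no nonzero finite `3`-cycles. -/
theorem coeff_eq_zero (hc : c ∈ supportedOn (IsCell 4)) (hbd : bd c = 0)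
    (x : Fin 4 → Fin 3 → ℤ) : coeff x c = 0 := by
  classical
  by_contra hne
  have hex : ∃ l, IsCell 4 l ∧ coeff x (of l) ≠ 0 := by
    by_contra h
    push Not at h
    exact hne (map_eq_of_supportedOn (f := coeff x) (g := 0) h hc)
  obtain ⟨l, ⟨-, hl⟩, hxl⟩ := hex
  obtain ⟨hinj, hmem, -⟩ := of_coeff_ne_zero hxl
  -- Sorted by height, four distinct pairwise adjacent points form a chain from `y 0` to `y 0 + 1`
  -- with heights rising by one.
  set π := Tuple.sort (height ∘ x) with hπ
  have hmono : Monotone ((height ∘ x) ∘ π) := Tuple.monotone_sort _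
  set y := x ∘ π with hy
  have hyinj : Function.Injective y := hinj.comp π.injective
  have hcl : ∀ i j, IsClose (y i) (y j) := fun i j => hl _ (hmem _) _ (hmem _)
  have hlt : ∀ i j, i < j → height (y i) < height (y j) := by
    intro i j hij
    refine lt_of_le_of_ne (hmono hij.le) fun e => ?_
    exact hij.ne (hyinj ((hcl i j).eq_of_height_eq e))
  have l01 := hlt 0 1 (by decide)
  have l12 := hlt 1 2 (by decide)
  have l23 := hlt 2 3 (by decide)
  have l03 := (hcl 0 3).le_of_height_lt (by omega)
  have hle := height_mono l03.2
  rw [height_add_one] at hle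
  have h30 : y 3 = y 0 + 1 := eq_of_le_of_height l03.2 (by rw [height_add_one]; omega)
  -- The cell continues to a staircase that repeats every three steps, translated by (1, 1, 1).
  set σ : ℕ → Fin 3 → ℤ := fun k => y (Fin.ofNat 3 k).castSucc + fun _ => ((k / 3 : ℕ) : ℤ) with hσ
  have h3 : ∀ k, σ (k + 3) = σ k + 1 := by
    intro k
    have e1 : (Fin.ofNat 3 (k + 3)) = Fin.ofNat 3 k := by
      ext; simp [Fin.ofNat]
    have e2 : (k + 3) / 3 = k / 3 + 1 := by omega
    simp only [hσ]
    rw [e1, e2]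
    ext i
    simp only [Pi.add_apply, Pi.one_apply]
    push_cast
    ring
  have hσ0 : σ 0 = y 0 := by ext i; simp [hσ]
  have hσ1 : σ 1 = y 1 := by ext i; simp [hσ]; rfl
  have hσ2 : σ 2 = y 2 := by ext i; simp [hσ]
  have hσ3 : σ 3 = y 3 := by rw [h30, ← hσ0, ← h3]
  have hy3 : height (y 3) = height (y 0) + 3 := by rw [h30, height_add_one]
  have hh : ∀ k, height (σ (k + 1)) = height (σ k) + 1 := by
    intro k
    induction k using Nat.strong_induction_on with
    | _ k ih =>
      rcases lt_or_ge k 3 with hk | hk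
      · interval_cases k
        · simp only [zero_add]; rw [hσ0, hσ1]; omega
        · simp only [Nat.reduceAdd]; rw [hσ1, hσ2]; omega
        · simp only [Nat.reduceAdd]; rw [hσ2, hσ3]; omega
      · obtain ⟨m, rfl⟩ := Nat.exists_eq_add_of_le' hk
        have e : m + 3 + 1 = (m + 1) + 3 := by ring
        rw [e, h3, h3, height_add_one, height_add_one, ih m (by omega)]
        ring
  have hzero := coeff_staircase_eq_zero hh h3 hc hbd
  have e : (fun i : Fin 4 => σ i) = x ∘ π := by
    ext1 i
    fin_cases i
    · exact hσ0
    · exact hσ1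
    · exact hσ2
    · exact hσ3
  rw [e, coeff_comp_perm] at hzero
  rcases mul_eq_zero.1 hzero with h | h
  · rcases Int.units_eq_one_or (Equiv.Perm.sign π) with h' | h' <;> simp [h'] at h
  · exact hne h

/-! ### Brick tiling of three-space -/

/-- The brick of a brick tiling of three-space that contains a given point. -/
noncomputable def brick (y : Fin 3 → ℝ) : Fin 3 → ℤ :=
  ![⌊y 0⌋, ⌊y 1 + ⌊y 0⌋ / 2⌋, ⌊y 2 + (⌊y 0⌋ + ⌊y 1 + ⌊y 0⌋ / 2⌋) / 3⌋]

theorem floor_le_floor_add_one {a b : ℝ} (h : b < a + 1) : ⌊b⌋ ≤ ⌊a⌋ + 1 := by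
  have h1 := Int.lt_floor_add_one a
  have h2 := Int.floor_le b
  have : ((⌊b⌋ : ℤ) : ℝ) < ((⌊a⌋ + 2 : ℤ) : ℝ) := by push_cast; linarith
  have := Int.cast_lt.1 this
  omega

/-- Bricks are compared lexicographically. Raising the first index shifts the second coordinate by
1/2; raising the sum of the first two by 1 or 2 shifts the third by 1/3 or 2/3. A displacement below
1/6 neither reverses such a shift nor carries it beyond 1, so every index stays or rises by one. -/
theorem isClose_brick_aux {y y' : Fin 3 → ℝ} (h : ∀ i, |y i - y' i| < 1 / 6)
    (hle : ⌊y 0⌋ < ⌊y' 0⌋ ∨ ⌊y 0⌋ = ⌊y' 0⌋ ∧ (⌊y 1 + ⌊y 0⌋ / 2⌋ < ⌊y' 1 + ⌊y' 0⌋ / 2⌋ ∨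
      ⌊y 1 + ⌊y 0⌋ / 2⌋ = ⌊y' 1 + ⌊y' 0⌋ / 2⌋ ∧ brick y 2 ≤ brick y' 2)) :
    IsClose (brick y) (brick y') := by
  have a0 := abs_lt.1 (h 0)
  have a1 := abs_lt.1 (h 1)
  have a2 := abs_lt.1 (h 2)
  left
  rw [le_iff, le_iff]
  have e0 : ∀ z, brick z 0 = ⌊z 0⌋ := fun z => rfl
  have e1 : ∀ z, brick z 1 = ⌊z 1 + ⌊z 0⌋ / 2⌋ := fun z => rfl
  have e2 : ∀ z, brick z 2 = ⌊z 2 + (⌊z 0⌋ + ⌊z 1 + ⌊z 0⌋ / 2⌋) / 3⌋ := fun z => rfl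
  have hb0 : ⌊y' 0⌋ ≤ ⌊y 0⌋ + 1 := floor_le_floor_add_one (by linarith)
  have hfloor : ⌊y 0⌋ ≤ ⌊y' 0⌋ ∧ ⌊y 1 + ⌊y 0⌋ / 2⌋ ≤ ⌊y' 1 + ⌊y' 0⌋ / 2⌋ ∧
      ⌊y' 1 + ⌊y' 0⌋ / 2⌋ ≤ ⌊y 1 + ⌊y 0⌋ / 2⌋ + 1 := by
    rcases hle with h0 | ⟨h0, h1⟩
    · have h0' : (⌊y' 0⌋ : ℝ) = ⌊y 0⌋ + 1 := by
        have : ⌊y' 0⌋ = ⌊y 0⌋ + 1 := by omega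
        rw [this]; push_cast; ring
      refine ⟨h0.le, Int.floor_le_floor ?_, floor_le_floor_add_one ?_⟩ <;>
        (rw [h0']; linarith)
    · refine ⟨h0.le, ?_, ?_⟩
      · rcases h1 with h1 | h1
        · exact h1.le
        · exact h1.1.le
      · rw [h0]
        exact floor_le_floor_add_one (by linarith)
  obtain ⟨hb0', hb1, hb1'⟩ := hfloor
  simp only [Pi.add_apply, Pi.one_apply, e0, e1]
  have hb2 : brick y 2 ≤ brick y' 2 ∧ brick y' 2 ≤ brick y 2 + 1 := by
    rw [e2, e2] at *
    generalize ⌊y 1 + ⌊y 0⌋ / 2⌋ = b1 at *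
    generalize ⌊y' 1 + ⌊y' 0⌋ / 2⌋ = b1' at *
    generalize ⌊y 0⌋ = b0 at *
    generalize ⌊y' 0⌋ = b0' at *
    have hup : b0' + b1' ≤ b0 + b1 + 2 := by omega
    have hup' : ((b0' + b1' : ℤ) : ℝ) ≤ ((b0 + b1 + 2 : ℤ) : ℝ) := Int.cast_le.2 hup
    push_cast at hup'
    refine ⟨?_, floor_le_floor_add_one (by linarith)⟩
    by_cases heq : b0 = b0' ∧ b1 = b1'
    · rcases hle with h0 | ⟨-, h1 | h1⟩
      · omega
      · omega
      · exact h1.2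
    · have hlo : b0 + b1 + 1 ≤ b0' + b1' := by omega
      have hlo' : ((b0 + b1 + 1 : ℤ) : ℝ) ≤ ((b0' + b1' : ℤ) : ℝ) := Int.cast_le.2 hlo
      push_cast at hlo'
      exact Int.floor_le_floor (by linarith)
  exact ⟨⟨hb0', hb1, hb2.1⟩, hb0, hb1', hb2.2⟩

theorem isClose_brick {y y' : Fin 3 → ℝ} (h : ∀ i, |y i - y' i| < 1 / 6) :
    IsClose (brick y) (brick y') := by
  have h' : ∀ i, |y' i - y i| < 1 / 6 := fun i => by rw [abs_sub_comm]; exact h i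
  rcases lt_trichotomy ⌊y 0⌋ ⌊y' 0⌋ with h0 | h0 | h0
  · exact isClose_brick_aux h (Or.inl h0)
  · rcases lt_trichotomy ⌊y 1 + ⌊y 0⌋ / 2⌋ ⌊y' 1 + ⌊y' 0⌋ / 2⌋ with h1 | h1 | h1
    · exact isClose_brick_aux h (Or.inr ⟨h0, Or.inl h1⟩)
    · rcases le_total (brick y 2) (brick y' 2) with h2 | h2
      · exact isClose_brick_aux h (Or.inr ⟨h0, Or.inr ⟨h1, h2⟩⟩)
      · exact (isClose_brick_aux h' (Or.inr ⟨h0.symm, Or.inr ⟨h1.symm, h2⟩⟩)).symm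
    · exact (isClose_brick_aux h' (Or.inr ⟨h0.symm, Or.inl h1⟩)).symm
  · exact (isClose_brick_aux h' (Or.inl h0)).symm

/-- Points of the same brick are subject to the same offsets, which cancel in the difference. -/
theorem abs_sub_lt_of_brick_eq {y y' : Fin 3 → ℝ} (h : brick y = brick y') (i : Fin 3) :
    |y i - y' i| < 1 := by
  have h0 : ⌊y 0⌋ = ⌊y' 0⌋ := congrFun h 0
  have h1 : ⌊y 1 + ⌊y 0⌋ / 2⌋ = ⌊y' 1 + ⌊y' 0⌋ / 2⌋ := congrFun h 1
  have h2 : ⌊y 2 + (⌊y 0⌋ + ⌊y 1 + ⌊y 0⌋ / 2⌋) / 3⌋ =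
    ⌊y' 2 + (⌊y' 0⌋ + ⌊y' 1 + ⌊y' 0⌋ / 2⌋) / 3⌋ := congrFun h 2
  fin_cases i
  · exact Int.abs_sub_lt_one_of_floor_eq_floor h0
  · have := Int.abs_sub_lt_one_of_floor_eq_floor h1
    rw [h0] at this
    simpa using this
  · have := Int.abs_sub_lt_one_of_floor_eq_floor h2
    rw [h1, h0] at this
    simpa using this

end Lattice

open ListChain

/-! ### Cycles in complexes that embed in three-space -/

section Cycle

variable {V : Type*} [Fintype V] {n : ℕ} {z : (Fin (n + 1) → V) → ℤ}

/-- An alternating function as a chain of ordered sequences. -/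
noncomputable def toListChain (z : (Fin n → V) → ℤ) : ListChain V :=
  ∑ w, z w • of (List.ofFn w)

/-- The `i`-th faces already cancel for each `i` separately: rotating the omitted entry to the front
absorbs the sign `(-1)^i`, and what remains is `boundary z`. -/
theorem bd_toListChain
    (halt : ∀ (w : Fin (n + 1) → V) (π : Equiv.Perm (Fin (n + 1))),
      z (w ∘ π) = ((Equiv.Perm.sign π : ℤˣ) : ℤ) * z w) (hbd : boundary z = 0) :
    bd (toListChain z) = 0 := by
  classical
  have hface : ∀ i : Fin (n + 1),
      ∑ w, z w • (-1 : ℤ) ^ (i : ℕ) • of (List.ofFn (w ∘ i.succAbove)) = 0 := by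
    intro i
    rw [← Equiv.sum_comp (Equiv.arrowCongr i.cycleRange.symm (Equiv.refl V))]
    have : ∀ w : Fin (n + 1) → V,
        z (Equiv.arrowCongr i.cycleRange.symm (Equiv.refl V) w) • (-1 : ℤ) ^ (i : ℕ) •
          of (List.ofFn (Equiv.arrowCongr i.cycleRange.symm (Equiv.refl V) w ∘ i.succAbove)) =
        z w • of (List.ofFn (Fin.tail w)) := by
      intro w
      have h1 : Equiv.arrowCongr i.cycleRange.symm (Equiv.refl V) w = w ∘ i.cycleRange := rfl
      have h2 : (w ∘ i.cycleRange) ∘ i.succAbove = Fin.tail w := by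
        ext1 j
        simp only [Function.comp_apply, Fin.cycleRange_succAbove]
        rfl
      rw [h1, h2, halt, Fin.sign_cycleRange, smul_smul]
      congr 1
      push_cast
      rw [mul_right_comm, ← pow_add, ← two_mul, pow_mul]
      simp
    rw [Finset.sum_congr rfl fun w _ => this w, ← Equiv.sum_comp (Fin.consEquiv fun _ => V),
      Fintype.sum_prod_type_right]
    refine Finset.sum_eq_zero fun t _ => ?_
    have h3 : ∀ u : V, z (Fin.consEquiv (fun _ => V) (u, t)) •
        of (List.ofFn (Fin.tail (Fin.consEquiv (fun _ => V) (u, t)))) =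
        z (Fin.cons u t) • of (List.ofFn t) := fun u => rfl
    rw [Finset.sum_congr rfl fun u _ => h3 u, ← Finset.sum_smul]
    have h4 : ∑ u, z (Fin.cons u t) = 0 := congrFun hbd t
    rw [h4, zero_smul]
  rw [toListChain, map_sum]
  simp only [map_zsmul, bd_ofFn, Finset.smul_sum]
  rw [Finset.sum_comm]
  exact Finset.sum_eq_zero fun i _ => hface i

/-- Each oriented simplex occurs in all `n!` orderings, with matching signs. -/
theorem coeff_toListChain {z : (Fin n → V) → ℤ}
    (halt : ∀ (w : Fin n → V) (π : Equiv.Perm (Fin n)),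
      z (w ∘ π) = ((Equiv.Perm.sign π : ℤˣ) : ℤ) * z w) (w : Fin n → V) :
    coeff w (toListChain z) = n.factorial * z w := by
  classical
  rw [toListChain, map_sum]
  simp only [map_zsmul, coeff_ofFn_eq_sum, smul_eq_mul, Finset.mul_sum]
  rw [Finset.sum_comm]
  have : ∀ π : Equiv.Perm (Fin n),
      (∑ v : Fin n → V, z v * ((Equiv.Perm.sign π : ℤ) *
        (open Classical in if v ∘ π = w then 1 else 0))) = z w := by
    intro π
    rw [Finset.sum_eq_single (w ∘ π.symm)]
    · have : (w ∘ π.symm) ∘ π = w := by ext1 i; simp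
      rw [if_pos this, halt, Equiv.Perm.sign_symm]
      rcases Int.units_eq_one_or (Equiv.Perm.sign π) with h | h <;> simp [h]
    · intro v _ hv
      rw [if_neg]
      · simp
      · rintro rfl
        apply hv
        ext1 i
        simp
    · simp
  rw [Finset.sum_congr rfl fun π _ => this π]
  simp [Finset.card_univ, Fintype.card_perm]

end Cycle

theorem exists_pos_of_simplex {V : Type*} [Fintype V] {x : V → ℝ} (hx : ∑ v, x v = 1) :
    ∃ v, 1 / (Fintype.card V : ℝ) ≤ x v := by
  by_contra h
  push Not at h
  have hne : (Finset.univ : Finset V).Nonempty := by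
    rw [Finset.nonempty_iff_ne_empty]
    intro e
    rw [e, Finset.sum_empty] at hx
    exact zero_ne_one hx
  have h1 := Finset.sum_lt_sum_of_nonempty hne fun v _ => h v
  rw [hx, Finset.sum_const, Finset.card_univ, nsmul_eq_mul] at h1
  have : (Fintype.card V : ℝ) ≠ 0 := by
    have := Finset.card_pos.2 hne
    rw [Finset.card_univ] at this
    exact_mod_cast this.ne'
  rw [mul_one_div_cancel this] at h1
  exact lt_irrefl _ h1

/-- On a compact set, a continuous injective map is uniformly injective. -/
theorem exists_dist_lt_of_injOn {E F : Type*} [PseudoMetricSpace E] [MetricSpace F] {X : Set E}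
    (hX : IsCompact X) {φ : E → F} (hφ : ContinuousOn φ X) (hinj : Set.InjOn φ X) {η : ℝ}
    (hη : 0 < η) : ∃ ρ > 0, ∀ x ∈ X, ∀ y ∈ X, dist (φ x) (φ y) < ρ → dist x y < η := by
  set S : Set (E × E) := {p | p ∈ X ×ˢ X ∧ η ≤ dist p.1 p.2} with hS
  have hcomp : IsCompact S :=
    (hX.prod hX).inter_right (isClosed_le continuous_const continuous_dist)
  rcases Set.eq_empty_or_nonempty S with he | hne
  · refine ⟨1, one_pos, fun x hx y hy _ => ?_⟩
    by_contra h
    have : (x, y) ∈ S := ⟨⟨hx, hy⟩, not_lt.1 h⟩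
    rw [he] at this
    exact this
  · have h1 : ContinuousOn (fun p : E × E => φ p.1) S :=
      hφ.comp continuousOn_fst fun p hp => hp.1.1
    have h2 : ContinuousOn (fun p : E × E => φ p.2) S :=
      hφ.comp continuousOn_snd fun p hp => hp.1.2
    have hcont : ContinuousOn (fun p : E × E => dist (φ p.1) (φ p.2)) S :=
      continuous_dist.comp_continuousOn (h1.prodMk h2)
    obtain ⟨p, hp, hmin⟩ := hcomp.exists_isMinOn hne hcont
    refine ⟨dist (φ p.1) (φ p.2), dist_pos.2 fun e => ?_, fun x hx y hy hxy => ?_⟩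
    · have := hp.2
      rw [hinj hp.1.1 hp.1.2 e, dist_self] at this
      linarith
    · by_contra h
      exact absurd (hmin (show (x, y) ∈ S from ⟨⟨hx, hy⟩, not_lt.1 h⟩)) (not_le.2 hxy)

/-- A `3`-cycle whose support embeds in three-space vanishes. -/
theorem eq_zero_of_embedding {V : Type*} [Fintype V] [DecidableEq V] {z : (Fin 4 → V) → ℤ}
    (halt : ∀ (w : Fin 4 → V) (π : Equiv.Perm (Fin 4)),
      z (w ∘ π) = ((Equiv.Perm.sign π : ℤˣ) : ℤ) * z w) (hbd : boundary z = 0)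
    {X : Set (V → ℝ)} (hX : IsCompact X) (hXs : ∀ x ∈ X, (∀ v, 0 ≤ x v) ∧ ∑ v, x v = 1)
    (hsub : ∀ w, z w ≠ 0 → simplexOn (List.ofFn w) ⊆ X) {φ : (V → ℝ) → Fin 3 → ℝ}
    (hφ : ContinuousOn φ X) (hinj : Set.InjOn φ X) : z = 0 := by
  classical
  by_contra hz
  obtain ⟨w₀, hw₀⟩ := Function.ne_iff.1 hz
  have hcard : 0 < (Fintype.card V : ℝ) := by
    exact_mod_cast Fintype.card_pos_iff.2 ⟨w₀ 0⟩
  -- Bricks of size `ρ` have preimages in which points are less than `1 / card V` apart, the size of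
  -- the largest coordinate guaranteed by `exists_pos_of_simplex`.
  obtain ⟨ρ, hρ, hρX⟩ := exists_dist_lt_of_injOn hX hφ hinj (η := 1 / (Fintype.card V : ℝ))
    (by positivity)
  -- After scaling by `ρ`, the bound `ρ / 6` becomes the tolerance 1/6 of `Lattice.isClose_brick`.
  obtain ⟨δ, hδ, hδX⟩ := Metric.uniformContinuousOn_iff.1
    (hX.uniformContinuousOn_of_continuous hφ) (ρ / 6) (by positivity)
  set β : (V → ℝ) → Fin 3 → ℤ := fun x => Lattice.brick fun i => φ x i / ρ with hβ
  have hβclose : ∀ x ∈ X, ∀ y ∈ X, dist x y < δ → Lattice.IsClose (β x) (β y) := by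
    intro x hx y hy hxy
    refine Lattice.isClose_brick fun i => ?_
    have h1 := (dist_le_pi_dist (φ x) (φ y) i).trans_lt (hδX x hx y hy hxy)
    rw [Real.dist_eq] at h1
    rw [← sub_div, abs_div, abs_of_pos hρ, div_lt_iff₀ hρ]
    linarith
  have hβeq : ∀ x ∈ X, ∀ y ∈ X, β x = β y → dist x y < 1 / (Fintype.card V : ℝ) := by
    intro x hx y hy hxy
    refine hρX x hx y hy ?_
    rw [dist_pi_lt_iff hρ]
    intro i
    have h1 := Lattice.abs_sub_lt_of_brick_eq hxy i
    rw [← sub_div, abs_div, abs_of_pos hρ, div_lt_iff₀ hρ] at h1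
    rw [Real.dist_eq]
    linarith
  -- Some coordinate `v` is at least `1 / card V` at one point of the brick, so it stays positive at
  -- all its points in `X`.
  have hlabel : ∀ p : Fin 3 → ℤ, ∃ v : V, ∀ x ∈ X, β x = p → 0 < x v := by
    intro p
    by_cases hp : ∃ a ∈ X, β a = p
    · obtain ⟨a, ha, rfl⟩ := hp
      obtain ⟨v, hv⟩ := exists_pos_of_simplex (hXs a ha).2
      refine ⟨v, fun x hx hxa => ?_⟩
      have h1 := (dist_le_pi_dist a x v).trans_lt (hβeq a ha x hx hxa.symm)
      rw [Real.dist_eq, abs_lt] at h1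
      linarith [h1.2]
    · exact ⟨w₀ 0, fun x hx hxp => absurd ⟨x, hx, hxp⟩ hp⟩
  choose lam hlam using hlabel
  -- Labels are also chosen outside `X`: the carrier argument applies to all simplices on `V`, not
  -- only those in the support of `z`.
  have hlabel' : ∀ x : V → ℝ, ∃ v : V, (x ∈ X → v = lam (β x)) ∧
      ((∀ v, 0 ≤ x v) → ∑ v, x v = 1 → 0 < x v) := by
    intro x
    by_cases hx : x ∈ X
    · exact ⟨lam (β x), fun _ => rfl, fun _ _ => hlam _ x hx rfl⟩
    · by_cases hs : ∑ v, x v = 1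
      · obtain ⟨v, hv⟩ := exists_pos_of_simplex hs
        exact ⟨v, fun h => absurd h hx, fun _ _ => lt_of_lt_of_le (by positivity) hv⟩
      · exact ⟨w₀ 0, fun h => absurd h hx, fun _ h => absurd h hs⟩
  choose lab hlabX hlab using hlabel'
  -- Sequences of length 4 then have mutual distances at most `4 · δ / 8 = δ / 2`.
  obtain ⟨Sd, hnil, hSd⟩ := exists_subdivision V (δ := δ / 8) (by positivity) 4
  set Z := toListChain z with hZ
  have hZsupp : Z ∈ supportedOn fun l => l.length = 4 ∧ simplexOn l ⊆ X := by
    rw [hZ, toListChain]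
    refine Submodule.sum_mem _ fun w _ => ?_
    by_cases hw : z w = 0
    · rw [hw, zero_smul]; exact Submodule.zero_mem _
    · exact Submodule.smul_mem _ _ (of_mem_supportedOn ⟨List.length_ofFn, hsub w hw⟩)
  have hSdZ : Sd Z ∈ supportedOn (IsSmall X 4 (δ / 2)) := by
    refine map_mem_of_supportedOn ?_ hZsupp
    rintro l ⟨hl, hlX⟩
    refine supportedOn_mono ?_ (hSd l hl.le).2
    rintro m ⟨h1, h2, h3⟩
    refine ⟨h1.trans hl, fun x hx => hlX (h2 x hx), fun x hx y hy => (h3 x hx y hy).trans ?_⟩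
    rw [hl]; push_cast; linarith
  have hbdSdZ : bd (Sd Z) = 0 := by
    have : bd (Sd Z) = Sd (bd Z) :=
      map_eq_of_supportedOn (f := bd ∘ₗ Sd) (g := Sd ∘ₗ bd) (fun l hl => (hSd l hl.1.le).1) hZsupp
    rw [this, hZ, bd_toListChain halt hbd, map_zero]
  set c := push β (Sd Z) with hc
  have hccell : c ∈ supportedOn (Lattice.IsCell 4) := by
    refine map_mem_of_supportedOn ?_ hSdZ
    rintro l ⟨h1, h2, h3⟩
    rw [push_of]
    refine of_mem_supportedOn ⟨by simp [h1], ?_⟩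
    intro p hp q hq
    rw [List.mem_map] at hp hq
    obtain ⟨x, hx, rfl⟩ := hp
    obtain ⟨y, hy, rfl⟩ := hq
    exact hβclose x (h2 x hx) y (h2 y hy) (by linarith [h3 x hx y hy])
  have hcbd : bd c = 0 := by rw [hc, bd_push, hbdSdZ, map_zero]
  have hzero : coeff w₀ (push lam c) = 0 :=
    coeff_push_eq_zero (supportedOn_mono (fun l hl => hl.1) hccell)
      (Lattice.coeff_eq_zero hccell hcbd) lam w₀
  have hfactor : push lab (Sd Z) = push lam c := by
    rw [hc, push_push]
    refine map_eq_of_supportedOn ?_ hSdZ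
    rintro l ⟨-, h2, -⟩
    rw [push_of, push_of]
    congr 1
    exact List.map_congr_left fun x hx => hlabX x (h2 x hx)
  -- Sperner's argument: each label belongs to the simplex carrying its point, so subdividing and
  -- labelling preserves coefficients.
  have hcarried : coeff w₀ (push lab (Sd Z)) = coeff w₀ Z := by
    refine map_eq_of_supportedOn (f := coeff w₀ ∘ₗ push lab ∘ₗ Sd) (g := coeff w₀) ?_ hZsupp
    rintro l ⟨hl, -⟩
    refine coeff_of_carried (Φ := push lab ∘ₗ Sd) (N := 4) ?_ ?_ ?_ le_rfl hl w₀
    · rw [LinearMap.comp_apply, hnil, push_of, List.map_nil]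
    · intro m hm
      rw [LinearMap.comp_apply, bd_push, (hSd m hm).1]; rfl
    · intro m hm
      refine map_mem_of_supportedOn (f := push lab) ?_ (hSd m hm).2
      rintro k ⟨h1, h2, -⟩
      rw [push_of]
      refine of_mem_supportedOn ⟨by simp [h1], ?_⟩
      intro v hv
      rw [List.mem_map] at hv
      obtain ⟨x, hx, rfl⟩ := hv
      obtain ⟨g1, g2, g3⟩ := h2 x hx
      exact g3 _ (hlab x g1 g2).ne'
  rw [hfactor, hzero, hZ, coeff_toListChain halt] at hcarried
  have : z w₀ = 0 := by
    simpa [Nat.factorial_ne_zero] using hcarried.symm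
  exact hw₀ this

theorem isCompact_simplexOn {V : Type*} [Fintype V] (l : List V) : IsCompact (simplexOn l) := by
  refine (isCompact_stdSimplex ℝ V).of_isClosed_subset ?_ fun x hx => ⟨hx.1, hx.2.1⟩
  have : simplexOn l = stdSimplex ℝ V ∩ ⋂ v ∈ {v : V | v ∉ l}, {x | x v = 0} := by
    ext x
    simp only [simplexOn, stdSimplex, Set.mem_ofPred_eq, Set.mem_inter_iff, Set.mem_iInter]
    constructor
    · rintro ⟨h1, h2, h3⟩
      exact ⟨⟨h1, h2⟩, fun v hv => by by_contra h; exact hv (h3 v h)⟩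
    · rintro ⟨⟨h1, h2⟩, h3⟩
      exact ⟨h1, h2, fun v hv => by by_contra h; exact hv (h3 v h)⟩
  rw [this]
  refine (isClosed_stdSimplex ℝ V).inter (isClosed_biInter fun v _ => ?_)
  exact isClosed_eq (continuous_apply v) continuous_const

/-- A nonzero `3`-cycle of a triangulated `3`-sphere involves every simplex. -/
theorem exists_subset_of_isCycle {V : Type*} [Fintype V] [DecidableEq V]
    {K : AbstractSimplicialComplex V} (hK : K.TriangulatesSphere 3) {z : (Fin 4 → V) → ℤ}
    (hz : K.IsCycle 3 z) (hz0 : z ≠ 0) {s : Finset V} (hs : s ∈ K.faces) :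
    ∃ w, z w ≠ 0 ∧ s ⊆ Finset.univ.image w := by
  classical
  by_contra hcon
  push Not at hcon
  obtain ⟨h⟩ := hK
  have hsne : s.Nonempty := (K.isRelLowerSet_faces hs).1
  set X : Set (V → ℝ) := ⋃ w ∈ {w : Fin 4 → V | z w ≠ 0}, simplexOn (List.ofFn w) with hX
  have hXcomp : IsCompact X :=
    (Set.toFinite _).isCompact_biUnion fun w _ => isCompact_simplexOn _
  have hXmem : ∀ x, x ∈ X ↔ ∃ w, z w ≠ 0 ∧ x ∈ simplexOn (List.ofFn w) := by
    intro x
    simp [hX]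
  have hXreal : ∀ x ∈ X, x ∈ K.realization := by
    intro x hx
    obtain ⟨w, hw, h1, h2, h3⟩ := (hXmem x).1 hx
    refine ⟨h1, h2, _, (hz.1.2 w hw).2, fun v hv => ?_⟩
    have := h3 v hv
    rw [List.mem_ofFn] at this
    obtain ⟨i, rfl⟩ := this
    exact Finset.mem_image_of_mem _ (Finset.mem_univ i)
  -- The barycentre of `s` lies only in those simplices that contain `s`, so it misses `X`.
  set b : V → ℝ := fun v => if v ∈ s then 1 / (s.card : ℝ) else 0 with hb
  have hcard : (0 : ℝ) < s.card := by exact_mod_cast Finset.card_pos.2 hsne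
  have hbreal : b ∈ K.realization := by
    refine ⟨fun v => ?_, ?_, s, hs, fun v hv => ?_⟩
    · simp only [hb]; split_ifs <;> positivity
    · simp only [hb]
      rw [Finset.sum_ite_mem, Finset.univ_inter, Finset.sum_const, nsmul_eq_mul,
        mul_one_div_cancel hcard.ne']
    · by_contra hvs
      exact hv (if_neg hvs)
  have hbX : b ∉ X := by
    intro hbX
    obtain ⟨w, hw, -, -, h3⟩ := (hXmem b).1 hbX
    refine hcon w hw fun v hv => ?_
    have hbv : b v ≠ 0 := by
      simp only [hb]
      rw [if_pos hv]
      positivity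
    have := h3 v hbv
    rw [List.mem_ofFn] at this
    obtain ⟨i, rfl⟩ := this
    exact Finset.mem_image_of_mem _ (Finset.mem_univ i)
  have hfact : Fact (Module.finrank ℝ (EuclideanSpace ℝ (Fin (3 + 1))) = 3 + 1) := ⟨by simp⟩
  -- Projecting from the image of the barycentre embeds `X` in three-space.
  set e := stereographic' 3 (h ⟨b, hbreal⟩) with he
  have hsource : ∀ x (hx : x ∈ X), h ⟨x, hXreal x hx⟩ ∈ e.source := by
    intro x hx
    rw [he, stereographic'_source, Set.mem_compl_iff, Set.mem_singleton_iff]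
    intro heq
    have := congrArg Subtype.val (h.injective heq)
    simp only at this
    exact hbX (this ▸ hx)
  set φ : (V → ℝ) → Fin 3 → ℝ := fun x =>
    if hx : x ∈ K.realization then (e (h ⟨x, hx⟩)).ofLp else 0 with hφ
  have hφX : ∀ x (hx : x ∈ X), φ x = (e (h ⟨x, hXreal x hx⟩)).ofLp := fun x hx =>
    dif_pos (hXreal x hx)
  have hcont : ContinuousOn φ X := by
    rw [continuousOn_iff_continuous_domRestrict]
    have h1 : X.domRestrict φ = fun x : X => (e (h ⟨x, hXreal x x.2⟩)).ofLp := by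
      ext1 x
      exact hφX x x.2
    rw [h1]
    refine (PiLp.continuous_ofLp 2 _).comp ?_
    refine e.continuousOn.comp_continuous ?_ fun x => hsource x x.2
    exact h.continuous.comp (continuous_subtype_val.subtype_mk _)
  have hinj : Set.InjOn φ X := by
    intro x hx y hy hxy
    rw [hφX x hx, hφX y hy] at hxy
    have h1 := e.injOn (hsource x hx) (hsource y hy) (WithLp.ofLp_injective 2 hxy)
    exact congrArg Subtype.val (h.injective h1)
  refine hz0 (eq_zero_of_embedding hz.1.1 hz.2 hXcomp
    (fun x hx => ⟨(hXreal x hx).1, (hXreal x hx).2.1⟩) (fun w hw x hx => ?_) hcont hinj)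
  exact (hXmem x).2 ⟨w, hw, hx⟩

/-! ### Boundaries of simplicial polytopes are triangulated spheres -/

section Polytope

variable {V ι : Type*} [Fintype V] {n : ℕ}

/-- The piecewise linear extension of a vertex map. -/
noncomputable def linearExtension (p : V → Fin (n + 1) → ℤ) (x : V → ℝ) :
    EuclideanSpace ℝ (Fin (n + 1)) :=
  WithLp.toLp 2 fun k => ∑ v, x v * p v k

theorem linearExtension_apply (p : V → Fin (n + 1) → ℤ) (x : V → ℝ) (k : Fin (n + 1)) :
    linearExtension p x k = ∑ v, x v * p v k := rfl

theorem continuous_linearExtension (p : V → Fin (n + 1) → ℤ) :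
    Continuous (linearExtension p) := by
  refine (PiLp.continuous_toLp 2 _).comp ?_
  fun_prop

theorem sum_mul_linearExtension (p : V → Fin (n + 1) → ℤ) (a : Fin (n + 1) → ℤ) (x : V → ℝ) :
    ∑ k, (a k : ℝ) * linearExtension p x k = ∑ v, x v * ((∑ k, a k * p v k : ℤ) : ℝ) := by
  simp only [linearExtension_apply, Finset.mul_sum]
  rw [Finset.sum_comm]
  refine Finset.sum_congr rfl fun v _ => ?_
  push_cast
  rw [Finset.mul_sum]
  exact Finset.sum_congr rfl fun k _ => by ring

/-- The value of a linear functional on a point, measured by its distances to the bound `b`. -/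
theorem sum_mul_linearExtension_eq_sub (p : V → Fin (n + 1) → ℤ) (a : Fin (n + 1) → ℤ) (b : ℤ)
    {x : V → ℝ} (hx : ∑ v, x v = 1) :
    ∑ k, (a k : ℝ) * linearExtension p x k =
      b - ∑ v, x v * (b - ((∑ k, a k * p v k : ℤ) : ℝ)) := by
  rw [sum_mul_linearExtension]
  simp only [mul_sub, Finset.sum_sub_distrib, ← Finset.sum_mul, hx]
  ring

theorem isCompact_realization (K : AbstractSimplicialComplex V) : IsCompact K.realization := by
  classical
  have : K.realization = ⋃ s ∈ K.faces, simplexOn s.toList := by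
    ext x
    simp only [realization, simplexOn, Set.mem_ofPred_eq, Set.mem_iUnion, Finset.mem_toList]
    constructor
    · rintro ⟨h1, h2, s, hs, h3⟩; exact ⟨s, hs, h1, h2, h3⟩
    · rintro ⟨s, hs, h1, h2, h3⟩; exact ⟨h1, h2, s, hs, h3⟩
  rw [this]
  exact (Set.toFinite _).isCompact_biUnion fun s _ => isCompact_simplexOn _

variable {p : V → Fin (n + 1) → ℤ} {a : ι → Fin (n + 1) → ℤ} {b : ι → ℤ}
  {K : AbstractSimplicialComplex V}

theorem exists_facet (hface : ∀ s ∈ K.faces, ∃ i, ∀ v ∈ s, ∑ k, a i k * p v k = b i) {x : V → ℝ}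
    (hx : x ∈ K.realization) :
    ∃ i, (∀ v, x v ≠ 0 → ∑ k, a i k * p v k = b i) ∧
      ∑ k, (a i k : ℝ) * linearExtension p x k = b i := by
  obtain ⟨-, h2, s, hs, h3⟩ := hx
  obtain ⟨i, hi⟩ := hface s hs
  refine ⟨i, fun v hv => hi v (h3 v hv), ?_⟩
  rw [sum_mul_linearExtension_eq_sub p (a i) (b i) h2, sub_eq_self]
  refine Finset.sum_eq_zero fun v _ => ?_
  by_cases hv : x v = 0
  · rw [hv, zero_mul]
  · rw [hi v (h3 v hv), sub_self, mul_zero]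

theorem linearExtension_ne_zero (hb : ∀ i, 0 < b i)
    (hface : ∀ s ∈ K.faces, ∃ i, ∀ v ∈ s, ∑ k, a i k * p v k = b i) {x : V → ℝ}
    (hx : x ∈ K.realization) : linearExtension p x ≠ 0 := by
  intro h
  obtain ⟨i, -, hi⟩ := exists_facet hface hx
  rw [h] at hi
  simp only [PiLp.zero_apply, mul_zero, Finset.sum_const_zero] at hi
  exact (hb i).ne (by exact_mod_cast hi)

/-- The inequality of a facet through the image of `x` also bounds the image of `y`. Applied both
ways, each ray meets the boundary at one distance only. -/
theorem le_one_of_smul_eq (hb : ∀ i, 0 < b i) (hle : ∀ i v, ∑ k, a i k * p v k ≤ b i)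
    (hface : ∀ s ∈ K.faces, ∃ i, ∀ v ∈ s, ∑ k, a i k * p v k = b i) {x y : V → ℝ}
    (hx : x ∈ K.realization) (hy : y ∈ K.realization) {t : ℝ}
    (h : linearExtension p y = t • linearExtension p x) : t ≤ 1 := by
  obtain ⟨i, -, hi⟩ := exists_facet hface hx
  have h1 : ∑ k, (a i k : ℝ) * linearExtension p y k = t * b i := by
    rw [h, ← hi, Finset.mul_sum]
    refine Finset.sum_congr rfl fun k _ => ?_
    rw [PiLp.smul_apply, smul_eq_mul]; ring
  rw [sum_mul_linearExtension_eq_sub p (a i) (b i) hy.2.1] at h1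
  have h2 : 0 ≤ ∑ v, y v * (b i - ((∑ k, a i k * p v k : ℤ) : ℝ)) := by
    refine Finset.sum_nonneg fun v _ => mul_nonneg (hy.1 v) (sub_nonneg.2 ?_)
    exact_mod_cast hle i v
  have h3 : (0 : ℝ) < b i := by exact_mod_cast hb i
  by_contra ht
  push Not at ht
  nlinarith

/-- Two preimages of a point are supported on the same facet. The neighbouring facet that contains
all its vertices but `v` has an inequality whose slack determines the coordinate at `v`. -/
theorem injOn_linearExtension (hle : ∀ i v, ∑ k, a i k * p v k ≤ b i)
    (hface : ∀ s ∈ K.faces, ∃ i, ∀ v ∈ s, ∑ k, a i k * p v k = b i)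
    (hopp : ∀ i v, ∑ k, a i k * p v k = b i → ∃ j, ∑ k, a j k * p v k < b j ∧
      ∀ w, w ≠ v → ∑ k, a i k * p w k = b i → ∑ k, a j k * p w k = b j) :
    Set.InjOn (linearExtension p) K.realization := by
  intro x hx y hy hxy
  obtain ⟨i, hxi, hi⟩ := exists_facet hface hx
  have hyi : ∀ v, y v ≠ 0 → ∑ k, a i k * p v k = b i := by
    rw [hxy, sum_mul_linearExtension_eq_sub p (a i) (b i) hy.2.1, sub_eq_self,
      Finset.sum_eq_zero_iff_of_nonneg] at hi
    · intro v hv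
      have := (mul_eq_zero.1 (hi v (Finset.mem_univ v))).resolve_left hv
      have h' : (b i : ℝ) = ((∑ k, a i k * p v k : ℤ) : ℝ) := by linarith
      exact_mod_cast h'.symm
    · intro v _
      refine mul_nonneg (hy.1 v) (sub_nonneg.2 ?_)
      exact_mod_cast hle i v
  ext v
  by_cases hv : ∑ k, a i k * p v k = b i
  · obtain ⟨j, hj1, hj2⟩ := hopp i v hv
    have key : ∀ z ∈ K.realization, (∀ w, z w ≠ 0 → ∑ k, a i k * p w k = b i) →
        ∑ k, (a j k : ℝ) * linearExtension p z k =
          b j - z v * (b j - ((∑ k, a j k * p v k : ℤ) : ℝ)) := by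
      intro z hz hzi
      rw [sum_mul_linearExtension_eq_sub p (a j) (b j) hz.2.1]
      congr 1
      refine Finset.sum_eq_single v (fun w _ hw => ?_) (by simp)
      by_cases hzw : z w = 0
      · rw [hzw, zero_mul]
      · rw [hj2 w hw (hzi w hzw), sub_self, mul_zero]
    have h1 := key x hx hxi
    rw [hxy, key y hy hyi] at h1
    have h2 : (0 : ℝ) < b j - ((∑ k, a j k * p v k : ℤ) : ℝ) := by
      rw [sub_pos]; exact_mod_cast hj1
    exact (mul_right_cancel₀ h2.ne' (sub_right_injective h1)).symm
  · have h1 : x v = 0 := by by_contra h; exact hv (hxi v h)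
    have h2 : y v = 0 := by by_contra h; exact hv (hyi v h)
    rw [h1, h2]

theorem exists_nonneg_combination
    (hspan : ∀ k : Fin (n + 1), ∃ (c c' : V → ℕ) (m : ℕ), 0 < m ∧
      (∀ l, ∑ w, (c w : ℤ) * p w l = if l = k then (m : ℤ) else 0) ∧
      (∀ l, ∑ w, (c' w : ℤ) * p w l = if l = k then -(m : ℤ) else 0))
    (y : EuclideanSpace ℝ (Fin (n + 1))) :
    ∃ x : V → ℝ, (∀ v, 0 ≤ x v) ∧ linearExtension p x = y := by
  choose c c' m hm hc hc' using hspan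
  refine ⟨fun v => ∑ k, (max (y k) 0 / m k * c k v + max (-y k) 0 / m k * c' k v), fun v => ?_, ?_⟩
  · positivity
  · ext l
    rw [linearExtension_apply]
    simp only [Finset.sum_mul]
    rw [Finset.sum_comm]
    have h : ∀ k, ∑ w, (max (y k) 0 / m k * c k w + max (-y k) 0 / m k * c' k w) * (p w l : ℝ) =
        if l = k then y k else 0 := by
      intro k
      have h1 : ∑ w, (c k w : ℝ) * (p w l : ℝ) = if l = k then (m k : ℝ) else 0 := by
        have := congrArg (Int.cast : ℤ → ℝ) (hc k l)
        push_cast at this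
        exact this
      have h2 : ∑ w, (c' k w : ℝ) * (p w l : ℝ) = if l = k then -(m k : ℝ) else 0 := by
        have := congrArg (Int.cast : ℤ → ℝ) (hc' k l)
        push_cast at this
        exact this
      simp only [add_mul, mul_assoc, Finset.sum_add_distrib, ← Finset.mul_sum, h1, h2]
      have hm' : (m k : ℝ) ≠ 0 := by exact_mod_cast (hm k).ne'
      split_ifs
      · have h3 : max (y k) 0 - max (-y k) 0 = y k := by
          rcases le_total 0 (y k) with h0 | h0
          · rw [max_eq_left h0, max_eq_right (by linarith), sub_zero]
          · rw [max_eq_right h0, max_eq_left (by linarith)]; ring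
        field_simp
        linarith
      · simp
    rw [Finset.sum_congr rfl fun k _ => h k]
    simp

/-- Among the nonnegative combinations of the vertices representing `y`, one of minimal total mass
exists by compactness. A nonedge in its support could be traded by `hneg` for smaller mass, so the
support is a clique, hence a simplex by flagness. -/
theorem exists_realization_of_ne_zero [DecidableEq V] (hK : K.IsFlag)
    (hneg : ∀ u v, u ≠ v → ({u, v} : Finset V) ∉ K.faces → ∃ (c : V → ℕ) (m : ℕ),
      ∑ w, c w < 2 * m ∧ ∀ k, (m : ℤ) * (p u k + p v k) = ∑ w, (c w : ℤ) * p w k)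
    (hspan : ∀ k : Fin (n + 1), ∃ (c c' : V → ℕ) (m : ℕ), 0 < m ∧
      (∀ l, ∑ w, (c w : ℤ) * p w l = if l = k then (m : ℤ) else 0) ∧
      (∀ l, ∑ w, (c' w : ℤ) * p w l = if l = k then -(m : ℤ) else 0))
    {y : EuclideanSpace ℝ (Fin (n + 1))} (hy : y ≠ 0) :
    ∃ x ∈ K.realization, ∃ t : ℝ, 0 < t ∧ linearExtension p x = t • y := by
  obtain ⟨x₀, hx₀, hx₀y⟩ := exists_nonneg_combination hspan y
  set M := ∑ v, x₀ v with hM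
  set C : Set (V → ℝ) := {x | (∀ v, 0 ≤ x v) ∧ ∑ v, x v ≤ M ∧ linearExtension p x = y} with hC
  have hCcomp : IsCompact C := by
    refine (isCompact_Icc (a := (0 : V → ℝ)) (b := fun _ => M)).of_isClosed_subset ?_ ?_
    · have h1 : IsClosed {x : V → ℝ | ∀ v, 0 ≤ x v} := by
        have : {x : V → ℝ | ∀ v, 0 ≤ x v} = ⋂ v, {x | 0 ≤ x v} := by ext; simp
        rw [this]
        exact isClosed_iInter fun v => isClosed_le continuous_const (continuous_apply v)
      refine h1.inter (IsClosed.inter ?_ ?_)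
      · exact isClosed_le (show Continuous fun x : V → ℝ => ∑ v, x v by fun_prop) continuous_const
      · exact isClosed_eq (continuous_linearExtension p) continuous_const
    · rintro x ⟨h1, h2, -⟩
      exact ⟨h1, fun v => (Finset.single_le_sum (fun w _ => h1 w) (Finset.mem_univ v)).trans h2⟩
  obtain ⟨x, hx, hmin⟩ := hCcomp.exists_isMinOn ⟨x₀, hx₀, le_rfl, hx₀y⟩
    (f := fun x : V → ℝ => ∑ v, x v)
    (show Continuous fun x : V → ℝ => ∑ v, x v by fun_prop).continuousOn
  obtain ⟨hx1, hx2, hx3⟩ := hx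
  have hpair : ∀ u v, x u ≠ 0 → x v ≠ 0 → ({u, v} : Finset V) ∈ K.faces := by
    intro u v hu hv
    by_contra hns
    have huv : u ≠ v := by
      rintro rfl
      exact hns (by simpa using K.singleton_mem u)
    obtain ⟨c, m, hcm, hrel⟩ := hneg u v huv hns
    have hm : 0 < m := by omega
    have hm' : (0 : ℝ) < m := by exact_mod_cast hm
    -- With this scale the coordinates at `u` and `v` stay nonnegative after `ε * m` is removed from
    -- both.
    set ε := min (x u) (x v) / m with hε
    have hu' : 0 < x u := lt_of_le_of_ne (hx1 u) (Ne.symm hu)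
    have hv' : 0 < x v := lt_of_le_of_ne (hx1 v) (Ne.symm hv)
    have hε0 : 0 < ε := div_pos (lt_min hu' hv') hm'
    have hεm : ε * m = min (x u) (x v) := by rw [hε]; field_simp
    set x' : V → ℝ := fun w => x w + ε * (c w - m * ((if w = u then 1 else 0) +
      if w = v then 1 else 0)) with hx'
    have hcm' : (∑ w, (c w : ℝ)) < 2 * m := by exact_mod_cast hcm
    have hsum : ∑ w, x' w = ∑ w, x w + ε * (∑ w, (c w : ℝ) - 2 * m) := by
      simp only [hx', Finset.sum_add_distrib, ← Finset.mul_sum, Finset.sum_sub_distrib,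
        Finset.sum_ite_eq', Finset.mem_univ, if_true]
      ring
    have hneg' : ε * (∑ w, (c w : ℝ) - 2 * m) < 0 :=
      mul_neg_of_pos_of_neg hε0 (by linarith)
    have hx'C : x' ∈ C := by
      refine ⟨fun w => ?_, by linarith, ?_⟩
      · have hcw : 0 ≤ ε * c w := by positivity
        have hmu : ε * m ≤ x u := hεm ▸ min_le_left _ _
        have hmv : ε * m ≤ x v := hεm ▸ min_le_right _ _
        have hxw := hx1 w
        simp only [hx']
        by_cases h1 : w = u
        · have h2 : w ≠ v := h1 ▸ huv
          rw [if_pos h1, if_neg h2, h1]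
          rw [h1] at hcw
          linarith
        · by_cases h2 : w = v
          · rw [if_neg h1, if_pos h2, h2]
            rw [h2] at hcw
            linarith
          · rw [if_neg h1, if_neg h2]
            linarith
      · rw [← hx3]
        ext k
        rw [linearExtension_apply, linearExtension_apply]
        have hrel' : (m : ℝ) * (p u k + p v k) = ∑ w, (c w : ℝ) * p w k := by
          have := congrArg (Int.cast : ℤ → ℝ) (hrel k)
          push_cast at this
          exact this
        have hterm : ∀ w, x' w * (p w k : ℝ) = x w * p w k + ε * (c w * p w k) -
            ε * m * ((if w = u then (p w k : ℝ) else 0) + if w = v then (p w k : ℝ) else 0) := by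
          intro w
          simp only [hx']
          split_ifs <;> ring
        rw [Finset.sum_congr rfl fun w _ => hterm w]
        simp only [Finset.sum_sub_distrib, Finset.sum_add_distrib, ← Finset.mul_sum,
          Finset.sum_ite_eq', Finset.mem_univ, if_true]
        rw [← hrel']
        ring
    have := hmin hx'C
    simp only [Set.mem_ofPred_eq] at this
    linarith
  set S := ∑ v, x v with hS
  have hSne : S ≠ 0 := by
    intro h0
    apply hy
    rw [Finset.sum_eq_zero_iff_of_nonneg fun v _ => hx1 v] at h0
    rw [← hx3]
    ext k
    rw [linearExtension_apply]
    exact Finset.sum_eq_zero fun v hv => by rw [h0 v hv, zero_mul]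
  have hSpos : 0 < S := lt_of_le_of_ne (Finset.sum_nonneg fun v _ => hx1 v) (Ne.symm hSne)
  have hsupp : (Finset.univ.filter fun v => x v ≠ 0) ∈ K.faces := by
    refine hK _ ?_ fun u hu v hv => hpair u v (Finset.mem_filter.1 hu).2 (Finset.mem_filter.1 hv).2
    rw [Finset.nonempty_iff_ne_empty]
    intro he
    apply hSne
    refine Finset.sum_eq_zero fun v _ => ?_
    by_contra hv
    exact Finset.notMem_empty v (he ▸ Finset.mem_filter.2 ⟨Finset.mem_univ v, hv⟩)
  refine ⟨fun v => S⁻¹ * x v, ⟨fun v => ?_, ?_, _, hsupp, fun v hv => ?_⟩, S⁻¹, by positivity, ?_⟩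
  · have := hx1 v
    positivity
  · rw [← Finset.mul_sum, inv_mul_cancel₀ hSne]
  · rw [Finset.mem_filter]
    exact ⟨Finset.mem_univ v, right_ne_zero_of_mul hv⟩
  · rw [← hx3]
    ext k
    rw [PiLp.smul_apply, linearExtension_apply, linearExtension_apply, smul_eq_mul, Finset.mul_sum]
    exact Finset.sum_congr rfl fun v _ => by ring

/-- A flag complex which is the boundary of a simplicial polytope triangulates the sphere. The
vertices of the polytope are `p v`, and its facets are given by the inequalities
`a i ⬝ y ≤ b i`. -/
theorem triangulatesSphere_of_polytope [DecidableEq V] (hK : K.IsFlag) (hb : ∀ i, 0 < b i)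
    (hle : ∀ i v, ∑ k, a i k * p v k ≤ b i)
    (hface : ∀ s ∈ K.faces, ∃ i, ∀ v ∈ s, ∑ k, a i k * p v k = b i)
    (hopp : ∀ i v, ∑ k, a i k * p v k = b i → ∃ j, ∑ k, a j k * p v k < b j ∧
      ∀ w, w ≠ v → ∑ k, a i k * p w k = b i → ∑ k, a j k * p w k = b j)
    (hneg : ∀ u v, u ≠ v → ({u, v} : Finset V) ∉ K.faces → ∃ (c : V → ℕ) (m : ℕ),
      ∑ w, c w < 2 * m ∧ ∀ k, (m : ℤ) * (p u k + p v k) = ∑ w, (c w : ℤ) * p w k)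
    (hspan : ∀ k : Fin (n + 1), ∃ (c c' : V → ℕ) (m : ℕ), 0 < m ∧
      (∀ l, ∑ w, (c w : ℤ) * p w l = if l = k then (m : ℤ) else 0) ∧
      (∀ l, ∑ w, (c' w : ℤ) * p w l = if l = k then -(m : ℤ) else 0)) :
    K.TriangulatesSphere n := by
  have hne : ∀ x : K.realization, linearExtension p x ≠ 0 :=
    fun x => linearExtension_ne_zero hb hface x.2
  set Φ : K.realization → Metric.sphere (0 : EuclideanSpace ℝ (Fin (n + 1))) 1 := fun x =>
    ⟨‖linearExtension p x‖⁻¹ • linearExtension p x, by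
      rw [mem_sphere_zero_iff_norm, norm_smul, norm_inv, norm_norm,
        inv_mul_cancel₀ (norm_ne_zero_iff.2 (hne x))]⟩ with hΦ
  have hcont : Continuous Φ := by
    have h1 : Continuous fun x : K.realization => linearExtension p x :=
      (continuous_linearExtension p).comp continuous_subtype_val
    exact Continuous.subtype_mk ((h1.norm.inv₀ fun x => norm_ne_zero_iff.2 (hne x)).smul h1) _
  have hinj : Function.Injective Φ := by
    intro x y hxy
    have h1 : ‖linearExtension p x‖⁻¹ • linearExtension p x =
        ‖linearExtension p y‖⁻¹ • linearExtension p y := congrArg Subtype.val hxy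
    have hx0 := norm_ne_zero_iff.2 (hne x)
    have hy0 := norm_ne_zero_iff.2 (hne y)
    have h2 : linearExtension p y =
        (‖linearExtension p y‖ * ‖linearExtension p x‖⁻¹) • linearExtension p x := by
      rw [mul_smul, h1, smul_smul, mul_inv_cancel₀ hy0, one_smul]
    have h3 : linearExtension p x =
        (‖linearExtension p x‖ * ‖linearExtension p y‖⁻¹) • linearExtension p y := by
      rw [mul_smul, ← h1, smul_smul, mul_inv_cancel₀ hx0, one_smul]
    have l1 := le_one_of_smul_eq hb hle hface x.2 y.2 h2
    have l2 := le_one_of_smul_eq hb hle hface y.2 x.2 h3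
    have px : 0 < ‖linearExtension p x‖ := norm_pos_iff.2 (hne x)
    have py : 0 < ‖linearExtension p y‖ := norm_pos_iff.2 (hne y)
    rw [← div_eq_mul_inv, div_le_one px] at l1
    rw [← div_eq_mul_inv, div_le_one py] at l2
    have heq : ‖linearExtension p x‖ = ‖linearExtension p y‖ := le_antisymm l2 l1
    rw [heq, mul_inv_cancel₀ hy0, one_smul] at h2
    exact Subtype.ext (injOn_linearExtension hle hface hopp x.2 y.2 h2.symm)
  have hsurj : Function.Surjective Φ := by
    rintro ⟨y, hy⟩
    rw [mem_sphere_zero_iff_norm] at hy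
    have hy0 : y ≠ 0 := by rintro rfl; simp at hy
    obtain ⟨x, hx, t, ht, hxt⟩ := exists_realization_of_ne_zero hK hneg hspan hy0
    refine ⟨⟨x, hx⟩, Subtype.ext ?_⟩
    change ‖linearExtension p x‖⁻¹ • linearExtension p x = y
    rw [hxt, norm_smul, hy, mul_one, Real.norm_of_nonneg ht.le, smul_smul,
      inv_mul_cancel₀ ht.ne', one_smul]
  have : CompactSpace K.realization := isCompact_iff_compactSpace.1 (isCompact_realization K)
  exact ⟨hcont.homeoOfEquivCompactToT2 (f := Equiv.ofBijective Φ ⟨hinj, hsurj⟩)⟩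

end Polytope

/-! ### The two triangulations as boundaries of polytopes -/

/-- The vertices of a polytope with boundary `T₁₂`. -/
def t12Point : Fin 12 → Fin 4 → ℤ :=
  ![
    ![-1, -2, -3, 0], ![1, -2, 1, -3], ![-2, -1, 2, 2], ![-1, 2, -3, 0], ![-2, 1, 1, -3],
    ![0, 2, 2, 2], ![2, 0, -3, 0], ![1, 1, 1, -3], ![2, -1, 2, 2], ![0, 0, -2, -3], ![0, 0, 3, -1],
    ![0, 0, -1, 3]]

/-- Normal vectors of the facets. -/
def t12Normal : Fin 33 → Fin 4 → ℤ :=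
  ![
    ![-23, -23, 4, -10], ![0, -23, 3, 4], ![-9, -9, -3, -10], ![46, -69, -17, 8],
    ![18, -27, -24, -20], ![-23, 0, -5, 1], ![-11, 0, -5, 7], ![0, -11, -1, 8], ![-9, 0, -6, -5],
    ![0, 0, -3, -1], ![0, 0, -3, 2], ![22, -33, -17, 26], ![-8, -8, 9, -5], ![0, -1, 1, 0],
    ![0, 0, 0, -1], ![0, 0, 1, -1], ![23, 0, 2, -5], ![9, 0, -3, -7], ![8, 0, 7, -3],
    ![-69, 46, 7, 17], ![-33, 22, -5, 29], ![-3, 2, 4, 0], ![0, 0, 3, 1], ![0, 0, 1, 3],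
    ![0, 23, 2, -5], ![0, 9, -3, -7], ![46, 69, -8, -3], ![22, 33, -14, 24], ![18, 27, -15, -17],
    ![0, 8, 7, -3], ![69, 46, 8, 3], ![33, 22, -6, 26], ![24, 16, 23, -3]]

def t12Bound : Fin 33 → ℤ :=
  ![
    57, 37, 36, 143, 108, 38, 26, 25, 27, 9, 9, 95, 32, 3, 3, 4, 40, 27, 24, 140, 92, 12, 8, 8, 40,
    27, 116, 86, 81, 24, 114, 84, 72]

/-- For `(u, v, m, c)` in the list, `m (p u + p v) = ∑ c w p w` where `∑ c w < 2 m`. -/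
def t12Relations : List (Fin 12 × Fin 12 × ℕ × (Fin 12 → ℕ)) :=
  [
    (0, 5, 26, ![3, 0, 8, 7, 0, 0, 0, 0, 0, 0, 0, 12]),
    (0, 7, 4, ![1, 1, 0, 0, 0, 0, 0, 0, 0, 3, 0, 0]),
    (0, 10, 171, ![75, 76, 63, 0, 23, 0, 0, 0, 0, 0, 0, 0]),
    (1, 3, 1, ![0, 0, 0, 0, 0, 0, 0, 0, 0, 1, 0, 0]),
    (1, 5, 3, ![0, 0, 0, 0, 0, 0, 0, 1, 1, 0, 2, 0]),
    (1, 11, 143, ![59, 48, 0, 0, 0, 0, 5, 0, 72, 0, 0, 0]),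
    (2, 6, 100, ![36, 0, 5, 0, 0, 0, 0, 0, 23, 0, 0, 48]),
    (2, 7, 4, ![0, 0, 1, 0, 1, 0, 0, 0, 0, 0, 3, 0]),
    (2, 9, 171, ![75, 19, 63, 0, 80, 0, 0, 0, 0, 0, 0, 0]),
    (3, 8, 86, ![0, 0, 0, 2, 0, 41, 44, 0, 0, 0, 0, 30]),
    (3, 10, 120, ![0, 0, 0, 48, 46, 39, 0, 20, 0, 0, 0, 0]),
    (4, 6, 3, ![0, 0, 0, 1, 0, 0, 0, 1, 0, 2, 0, 0]),
    (4, 8, 1, ![0, 0, 0, 0, 0, 0, 0, 0, 0, 0, 1, 0]),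
    (4, 11, 35, ![0, 0, 15, 16, 12, 3, 0, 0, 0, 0, 0, 0]),
    (5, 9, 40, ![0, 0, 0, 16, 2, 13, 0, 20, 0, 0, 0, 0]),
    (6, 10, 40, ![0, 3, 0, 0, 0, 0, 16, 19, 13, 0, 0, 0]),
    (7, 11, 114, ![0, 0, 0, 0, 0, 43, 40, 30, 2, 0, 0, 0]),
    (8, 9, 120, ![0, 49, 0, 0, 0, 0, 48, 17, 39, 0, 0, 0]),
    (9, 10, 27, ![0, 11, 0, 0, 11, 0, 0, 11, 0, 3, 0, 0]),
    (9, 11, 3, ![1, 0, 0, 1, 0, 0, 1, 0, 0, 0, 0, 0]),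
    (10, 11, 3, ![0, 0, 1, 0, 0, 1, 0, 0, 1, 0, 0, 0])]

/-- Multiples of the unit vectors and their negatives as nonnegative combinations. -/
def t12Positive : Fin 4 → Fin 12 → ℕ :=
  ![
    ![0, 0, 0, 0, 0, 4, 32, 24, 32, 0, 0, 0], ![0, 0, 0, 814, 0, 999, 74, 666, 0, 0, 0, 0],
    ![0, 0, 3, 0, 0, 3, 0, 0, 3, 0, 18, 0], ![0, 0, 9, 0, 0, 9, 0, 0, 9, 0, 0, 54]]

def t12Negative : Fin 4 → Fin 12 → ℕ :=
  ![
    ![13, 0, 36, 19, 24, 0, 0, 0, 0, 0, 0, 0], ![928, 696, 464, 0, 0, 0, 0, 0, 580, 0, 0, 0],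
    ![8, 0, 0, 8, 0, 0, 8, 0, 0, 0, 0, 0], ![0, 16, 0, 0, 16, 0, 0, 16, 0, 24, 0, 0]]

/-- The factor by which the unit vectors are multiplied in `t12Positive` and `t12Negative`. -/
def t12Multiple : Fin 4 → ℕ := ![152, 4292, 72, 216]

/-- Allowing repetitions makes one check cover the simplices of all dimensions; ordering the
vertices keeps the number of cases down. -/
theorem exists_t12Normal_of_adj : ∀ a b : Fin 12, a ≤ b → (a = b ∨ t12Adj a b = true) →
    ∀ c, b ≤ c → (a = c ∨ t12Adj a c = true) → (b = c ∨ t12Adj b c = true) →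
    ∀ d, c ≤ d → (a = d ∨ t12Adj a d = true) → (b = d ∨ t12Adj b d = true) →
    (c = d ∨ t12Adj c d = true) → ∃ i, ∀ v ∈ [a, b, c, d],
      ∑ k, t12Normal i k * t12Point v k = t12Bound i := by
  simp only [Fin.sum_univ_four]
  decide +kernel

theorem exists_t12Normal {s : Finset (Fin 12)} (hs : s ∈ T12.faces) :
    ∃ i, ∀ v ∈ s, ∑ k, t12Normal i k * t12Point v k = t12Bound i := by
  have hadj : ∀ a ∈ s, ∀ b ∈ s, a = b ∨ t12Adj a b = true := by
    intro a ha b hb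
    by_cases hab : a = b
    · exact Or.inl hab
    · exact Or.inr ((t12Adj_iff a b).2 (hs.2 ha hb hab))
  have key : ∀ l : List (Fin 12), l.Pairwise (· ≤ ·) → (∀ v ∈ l, v ∈ s) → l.length ≤ 4 → l ≠ [] →
      ∃ i, ∀ v ∈ l, ∑ k, t12Normal i k * t12Point v k = t12Bound i := by
    intro l hl hls hlen hne
    match l, hne with
    | [a], _ =>
      simp only [List.mem_cons, List.not_mem_nil, or_false, forall_eq] at hls
      obtain ⟨i, hi⟩ := exists_t12Normal_of_adj a a le_rfl (Or.inl rfl) a le_rfl (Or.inl rfl)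
        (Or.inl rfl) a le_rfl (Or.inl rfl) (Or.inl rfl) (Or.inl rfl)
      exact ⟨i, fun v hv => hi v (by simp at hv ⊢; tauto)⟩
    | [a, b], _ =>
      simp only [List.pairwise_cons, List.mem_cons, List.not_mem_nil, or_false,
        forall_eq_or_imp, forall_eq] at hl hls
      obtain ⟨i, hi⟩ := exists_t12Normal_of_adj a b (by tauto) (hadj a (by tauto) b (by tauto))
        b le_rfl (hadj a (by tauto) b (by tauto)) (Or.inl rfl) b le_rfl
        (hadj a (by tauto) b (by tauto)) (Or.inl rfl) (Or.inl rfl)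
      exact ⟨i, fun v hv => hi v (by simp at hv ⊢; tauto)⟩
    | [a, b, c], _ =>
      simp only [List.pairwise_cons, List.mem_cons, List.not_mem_nil, or_false,
        forall_eq_or_imp, forall_eq] at hl hls
      obtain ⟨i, hi⟩ := exists_t12Normal_of_adj a b (by tauto) (hadj a (by tauto) b (by tauto))
        c (by tauto) (hadj a (by tauto) c (by tauto)) (hadj b (by tauto) c (by tauto)) c le_rfl
        (hadj a (by tauto) c (by tauto)) (hadj b (by tauto) c (by tauto)) (Or.inl rfl)
      exact ⟨i, fun v hv => hi v (by simp at hv ⊢; tauto)⟩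
    | [a, b, c, d], _ =>
      simp only [List.pairwise_cons, List.mem_cons, List.not_mem_nil, or_false,
        forall_eq_or_imp, forall_eq] at hl hls
      exact exists_t12Normal_of_adj a b (by tauto) (hadj a (by tauto) b (by tauto))
        c (by tauto) (hadj a (by tauto) c (by tauto)) (hadj b (by tauto) c (by tauto)) d (by tauto)
        (hadj a (by tauto) d (by tauto)) (hadj b (by tauto) d (by tauto))
        (hadj c (by tauto) d (by tauto))
    | _ :: _ :: _ :: _ :: _ :: _, _ => simp at hlen; omega
  obtain ⟨i, hi⟩ := key (s.sort (· ≤ ·)) (s.pairwise_sort (· ≤ ·)) (by simp)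
    (by simpa using card_le_four_of_mem_T12 hs)
    (fun h => by simpa [h] using (s.mem_sort (· ≤ ·)).2 hs.1.choose_spec)
  exact ⟨i, fun v hv => hi v (by simpa using hv)⟩

theorem triangulatesSphere_T12 : T12.TriangulatesSphere 3 := by
  refine triangulatesSphere_of_polytope (p := t12Point) (a := t12Normal) (b := t12Bound)
    (isFlag_flagComplex _) ?_ ?_ (fun s hs => exists_t12Normal hs) ?_ ?_ ?_
  · decide +kernel
  · decide +kernel
  · decide +kernel
  · have h : ∀ u v : Fin 12, u ≠ v → t12Adj u v = false → ∃ x ∈ t12Relations,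
        (x.1 = u ∧ x.2.1 = v ∨ x.1 = v ∧ x.2.1 = u) ∧ ∑ w, x.2.2.2 w < 2 * x.2.2.1 ∧
        ∀ k, (x.2.2.1 : ℤ) * (t12Point x.1 k + t12Point x.2.1 k) =
          ∑ w, (x.2.2.2 w : ℤ) * t12Point w k := by
      decide +kernel
    intro u v huv hns
    obtain ⟨x, -, hx, h1, h2⟩ := h u v huv (by
      rw [← Bool.not_eq_true]
      exact fun h => hns ((pair_mem_flagComplex huv).2 ((t12Adj_iff u v).1 h)))
    refine ⟨x.2.2.2, x.2.2.1, h1, fun k => ?_⟩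
    rw [← h2 k]
    rcases hx with ⟨rfl, rfl⟩ | ⟨rfl, rfl⟩
    · rfl
    · rw [add_comm]
  · intro k
    refine ⟨t12Positive k, t12Negative k, t12Multiple k, ?_, ?_, ?_⟩
    · revert k; decide +kernel
    · revert k; decide +kernel
    · revert k; decide +kernel

theorem isPositiveFlagSphere_T12 : T12.IsPositiveFlagSphere :=
  ⟨isFlag_flagComplex _, triangulatesSphere_T12, by rw [gammaTwo_T12]; exact one_pos⟩

/-! ### The join of two pentagons -/

def pentagonAdj (i j : Fin 5) : Bool := decide (i = j + 1 ∨ j = i + 1)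

theorem pentagonAdj_iff (i j : Fin 5) :
    pentagonAdj i j = true ↔ (SimpleGraph.cycleGraph 5).Adj i j := by
  rw [SimpleGraph.cycleGraph_adj]
  revert i j
  decide

def t10Adj : Fin 5 ⊕ Fin 5 → Fin 5 ⊕ Fin 5 → Bool
  | .inl i, .inl j => pentagonAdj i j
  | .inr i, .inr j => pentagonAdj i j
  | _, _ => true

theorem mem_T10_iff {s : Finset (Fin 5 ⊕ Fin 5)} : s ∈ T10.faces ↔
    s.Nonempty ∧ ∀ v ∈ s, ∀ w ∈ s, v ≠ w → t10Adj v w = true := by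
  have key : ∀ t : Finset (Fin 5), (t = ∅ ∨ t ∈ pentagon.faces) ↔
      ∀ i ∈ t, ∀ j ∈ t, i ≠ j → pentagonAdj i j = true := by
    intro t
    rcases t.eq_empty_or_nonempty with rfl | ht
    · simp
    · constructor
      · rintro (rfl | h)
        · simp
        · exact fun i hi j hj hij => (pentagonAdj_iff i j).2 (h.2 hi hj hij)
      · exact fun h => Or.inr ⟨ht, fun i hi j hj hij => (pentagonAdj_iff i j).1 (h i hi j hj hij)⟩
  change s.Nonempty ∧ (s.toLeft = ∅ ∨ s.toLeft ∈ pentagon.faces) ∧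
    (s.toRight = ∅ ∨ s.toRight ∈ pentagon.faces) ↔ _
  rw [key, key]
  simp [t10Adj]

theorem pair_mem_T10_iff {v w : Fin 5 ⊕ Fin 5} (h : v ≠ w) :
    ({v, w} : Finset (Fin 5 ⊕ Fin 5)) ∈ T10.faces ↔ t10Adj v w = true := by
  have hs : ∀ v w, t10Adj v w = t10Adj w v := by decide
  rw [mem_T10_iff]
  constructor
  · exact fun hvw => hvw.2 v (by simp) w (by simp) h
  · refine fun hvw => ⟨⟨v, by simp⟩, ?_⟩
    intro x hx y hy hxy
    simp only [Finset.mem_insert, Finset.mem_singleton] at hx hy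
    rcases hx with rfl | rfl <;> rcases hy with rfl | rfl
    · exact absurd rfl hxy
    · exact hvw
    · rw [hs]; exact hvw
    · exact absurd rfl hxy

theorem isFlag_T10 : T10.IsFlag := fun _ hs h =>
  mem_T10_iff.2 ⟨hs, fun v hv w hw hvw => (pair_mem_T10_iff hvw).1 (h v hv w hw)⟩

theorem gammaTwo_T10 : T10.gammaTwo = 1 := by
  have h : ∀ i, T10.fNum i = cliqueCount t10Adj (i + 1)
      ((List.finRange 5).map Sum.inl ++ (List.finRange 5).map Sum.inr) := by
    refine fNum_eq_cliqueCount isFlag_T10 (fun v w h => (pair_mem_T10_iff h).symm) ?_ ?_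
    · decide
    · simp
  have h3 : T10.fNum 3 = 25 := by rw [h]; decide +kernel
  have h2 : T10.fNum 2 = 50 := by rw [h]; decide +kernel
  have h1 : T10.fNum 1 = 35 := by rw [h]; decide +kernel
  have h0 : T10.fNum 0 = 10 := by rw [h]; decide +kernel
  rw [gammaTwo, h3, h2, h1, h0]
  norm_num

def pentagonPoint : Fin 5 → Fin 2 → ℤ := ![![1, 0], ![1, 1], ![0, 1], ![-1, 0], ![0, -1]]

def pentagonNormal : Fin 5 → Fin 2 → ℤ := ![![1, 0], ![0, 1], ![-1, 1], ![-1, -1], ![1, -1]]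

/-- The vertices of the free sum of two pentagons, the boundary of which is `T₁₀`. -/
def t10Point : Fin 5 ⊕ Fin 5 → Fin 4 → ℤ :=
  Sum.elim (fun i => ![pentagonPoint i 0, pentagonPoint i 1, 0, 0])
    (fun i => ![0, 0, pentagonPoint i 0, pentagonPoint i 1])

def t10Normal (x : Fin 5 × Fin 5) : Fin 4 → ℤ :=
  ![pentagonNormal x.1 0, pentagonNormal x.1 1, pentagonNormal x.2 0, pentagonNormal x.2 1]

/-- The empty set is included, since a simplex of the join may miss one of the pentagons. -/
theorem exists_pentagonNormal : ∀ t : Finset (Fin 5),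
    (∀ i ∈ t, ∀ j ∈ t, i ≠ j → pentagonAdj i j = true) → ∃ k, ∀ i ∈ t,
      pentagonNormal k 0 * pentagonPoint i 0 + pentagonNormal k 1 * pentagonPoint i 1 = 1 := by
  decide +kernel

theorem triangulatesSphere_T10 : T10.TriangulatesSphere 3 := by
  refine triangulatesSphere_of_polytope (p := t10Point) (a := t10Normal) (b := fun _ => 1)
    isFlag_T10 (fun _ => one_pos) ?_ ?_ ?_ ?_ ?_
  · decide +kernel
  · intro s hs
    rw [mem_T10_iff] at hs
    obtain ⟨k, hk⟩ := exists_pentagonNormal s.toLeft fun i hi j hj hij =>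
      hs.2 _ (Finset.mem_toLeft.1 hi) _ (Finset.mem_toLeft.1 hj) (by simpa using hij)
    obtain ⟨l, hl⟩ := exists_pentagonNormal s.toRight fun i hi j hj hij =>
      hs.2 _ (Finset.mem_toRight.1 hi) _ (Finset.mem_toRight.1 hj) (by simpa using hij)
    refine ⟨(k, l), ?_⟩
    rintro (i | i) hi
    · simpa [Fin.sum_univ_four, t10Normal, t10Point] using hk i (Finset.mem_toLeft.2 hi)
    · simpa [Fin.sum_univ_four, t10Normal, t10Point] using hl i (Finset.mem_toRight.2 hi)
  · decide +kernel
  · have h : ∀ u v, u ≠ v → t10Adj u v = false →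
        ∑ w, (if t10Point w = t10Point u + t10Point v then 1 else 0) < 2 * 1 ∧
        ∀ k, ((1 : ℕ) : ℤ) * (t10Point u k + t10Point v k) =
          ∑ w, ((if t10Point w = t10Point u + t10Point v then 1 else 0 : ℕ) : ℤ) *
            t10Point w k := by
      decide +kernel
    intro u v huv hns
    exact ⟨_, 1, h u v huv (by
      rw [← Bool.not_eq_true]
      exact fun h => hns ((pair_mem_T10_iff huv).2 h))⟩
  · have h : ∀ k : Fin 4,
        (∀ l, ∑ w, ((if t10Point w = Pi.single k 1 then 1 else 0 : ℕ) : ℤ) * t10Point w l =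
          if l = k then ((1 : ℕ) : ℤ) else 0) ∧
        ∀ l, ∑ w, ((if t10Point w = Pi.single k (-1) then 1 else 0 : ℕ) : ℤ) * t10Point w l =
          if l = k then -((1 : ℕ) : ℤ) else 0 := by
      decide +kernel
    exact fun k => ⟨_, _, 1, one_pos, h k⟩

theorem isPositiveFlagSphere_T10 : T10.IsPositiveFlagSphere :=
  ⟨isFlag_T10, triangulatesSphere_T10, by rw [gammaTwo_T10]; exact one_pos⟩

/-! ### Flag spheres with at most eight vertices -/

theorem pair_mem_of_mem {W : Type*} [DecidableEq W] {L : AbstractSimplicialComplex W}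
    {s : Finset W} (hs : s ∈ L.faces) {x y : W} (hx : x ∈ s) (hy : y ∈ s) :
    ({x, y} : Finset W) ∈ L.faces :=
  (L.isRelLowerSet_faces hs).2 (by intro v hv; simp at hv; rcases hv with rfl | rfl <;> assumption)
    ⟨x, by simp⟩

/-- Otherwise the face opposite to `w i` would have a nonzero coefficient in the boundary; a swap
brings the index `i` to the front. -/
theorem exists_ne_of_isCycle {W : Type*} [Fintype W] [DecidableEq W]
    {L : AbstractSimplicialComplex W} {n : ℕ} {z : (Fin (n + 1) → W) → ℤ} (hz : L.IsCycle n z)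
    {w : Fin (n + 1) → W} (hw : z w ≠ 0) (i : Fin (n + 1)) :
    ∃ v, v ≠ w i ∧ z (Function.update w i v) ≠ 0 := by
  have h0 : ∀ v, z (Fin.cons v (Fin.tail (w ∘ Equiv.swap 0 i))) ≠ 0 ↔
      z (Function.update w i v) ≠ 0 := by
    intro v
    have h : (Fin.cons v (Fin.tail (w ∘ Equiv.swap 0 i)) : Fin (n + 1) → W) =
        Function.update w i v ∘ Equiv.swap 0 i := by
      funext k
      refine Fin.cases ?_ (fun k => ?_) k
      · simp
      · rw [Fin.cons_succ, Fin.tail, Function.comp_apply, Function.comp_apply,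
          Function.update_of_ne]
        intro h
        rw [Equiv.swap_apply_eq_iff, Equiv.swap_apply_right] at h
        exact Fin.succ_ne_zero k h
    rw [h, hz.1.1]
    simp
  by_contra! hcon
  have hsum := congrFun hz.2 (Fin.tail (w ∘ Equiv.swap 0 i))
  rw [boundary, Finset.sum_eq_single (w i)] at hsum
  · exact (h0 (w i)).2 (by simpa using hw) hsum
  · intro v _ hv
    by_contra h
    exact (h0 v).1 h (hcon v hv)
  · simp

/-- `u i` is the apex of a second simplex on the face opposite to `w i`. Adjacency of `u i` and `w
i` would, by flagness, give a simplex of too high dimension. If `u i = u j` with `i ≠ j`, then `u j`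
would be adjacent to `w j`. -/
theorem exists_opposite {W : Type*} [Fintype W] [DecidableEq W]
    {L : AbstractSimplicialComplex W} (hL : L.IsFlag) {n : ℕ}
    (hdim : ∀ s ∈ L.faces, s.card ≤ n + 1) {z : (Fin (n + 1) → W) → ℤ}
    (hz : L.IsCycle n z) {w : Fin (n + 1) → W} (hw : z w ≠ 0) :
    ∃ u : Fin (n + 1) → W, (∀ i, ({u i, w i} : Finset W) ∉ L.faces) ∧
      (∀ i j, i ≠ j → ({u i, w j} : Finset W) ∈ L.faces) ∧
      Function.Injective (Sum.elim w u) := by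
  obtain ⟨hwi, hwf⟩ := hz.1.2 w hw
  have hwm : ∀ i, w i ∈ Finset.univ.image w := fun i => Finset.mem_image_of_mem _ (by simp)
  choose u hu hu' using exists_ne_of_isCycle hz hw
  have hadj : ∀ i j, i ≠ j → u i ≠ w j ∧ ({u i, w j} : Finset W) ∈ L.faces := by
    intro i j hij
    obtain ⟨h1, h2⟩ := hz.1.2 _ (hu' i)
    constructor
    · intro h
      apply hij
      apply h1
      simp [Function.update_of_ne hij.symm, h]
    · apply pair_mem_of_mem h2
      · exact Finset.mem_image.2 ⟨i, by simp⟩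
      · exact Finset.mem_image.2 ⟨j, by simp [Function.update_of_ne hij.symm]⟩
  have hne : ∀ i j, u i ≠ w j := by
    intro i j
    by_cases hij : i = j
    · exact hij ▸ hu i
    · exact (hadj i j hij).1
  have hnot : ∀ i, ({u i, w i} : Finset W) ∉ L.faces := by
    intro i hi
    have hall : ∀ j, ({u i, w j} : Finset W) ∈ L.faces := by
      intro j
      by_cases hij : i = j
      · exact hij ▸ hi
      · exact (hadj i j hij).2
    have hmem : insert (u i) (Finset.univ.image w) ∈ L.faces := by
      refine hL _ ⟨u i, by simp⟩ ?_
      intro x hx y hy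
      rcases Finset.mem_insert.1 hx with rfl | hx <;> rcases Finset.mem_insert.1 hy with rfl | hy
      · simpa using L.singleton_mem (u i)
      · obtain ⟨j, -, rfl⟩ := Finset.mem_image.1 hy
        exact hall j
      · obtain ⟨j, -, rfl⟩ := Finset.mem_image.1 hx
        rw [Finset.pair_comm]
        exact hall j
      · exact pair_mem_of_mem hwf hx hy
    have := hdim _ hmem
    rw [Finset.card_insert_of_notMem (by simpa using fun j => (hne i j).symm),
      Finset.card_image_of_injective _ hwi, Finset.card_univ, Fintype.card_fin] at this
    omega
  refine ⟨u, hnot, fun i j hij => (hadj i j hij).2, hwi.sumElim ?_ fun i j => (hne j i).symm⟩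
  intro i j hij
  by_contra h
  exact hnot j (hij ▸ (hadj i j h).2)

theorem nine_le_card {W : Type*} [Fintype W] [DecidableEq W] {L : AbstractSimplicialComplex W}
    (hL : L.IsFlag) {z : (Fin 4 → W) → ℤ} (hz : L.IsCycle 3 z) (hz0 : z ≠ 0)
    (hsupp : ∀ s ∈ L.faces, ∃ w, z w ≠ 0 ∧ s ⊆ Finset.univ.image w) (hγ : 0 < L.gammaTwo) :
    9 ≤ Fintype.card W := by
  have hdim : ∀ s ∈ L.faces, s.card ≤ 4 := by
    intro s hs
    obtain ⟨w, -, hsw⟩ := hsupp s hs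
    exact (Finset.card_le_card hsw).trans (Finset.card_image_le.trans (by simp))
  obtain ⟨w, hw⟩ := Function.ne_iff.1 hz0
  obtain ⟨u, hnot, hadj, hinj⟩ := exists_opposite hL hdim hz hw
  have h8 := Fintype.card_le_of_injective _ hinj
  simp only [Fintype.card_sum, Fintype.card_fin] at h8
  by_contra hcon
  have hcard : Fintype.card W = 8 := by omega
  -- A tetrahedron through `x` and its four opposite vertices exhaust the eight vertices, so `x` has
  -- a single non-neighbour.
  have hunique : ∀ x y y', x ≠ y → x ≠ y' → ({x, y} : Finset W) ∉ L.faces →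
      ({x, y'} : Finset W) ∉ L.faces → y = y' := by
    intro x y y' hxy hxy' hy hy'
    obtain ⟨w, hw, hxw⟩ := hsupp {x} (L.singleton_mem x)
    obtain ⟨u, -, hadj, hinj⟩ := exists_opposite hL hdim hz hw
    have hsurj := ((Fintype.bijective_iff_injective_and_card _).2 ⟨hinj, by simp [hcard]⟩).2
    rw [Finset.singleton_subset_iff] at hxw
    obtain ⟨i, -, rfl⟩ := Finset.mem_image.1 hxw
    have key : ∀ y, ({w i, y} : Finset W) ∉ L.faces → y = u i := by
      intro y hy
      obtain ⟨j | j, rfl⟩ := hsurj y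
      · exact absurd (pair_mem_of_mem (hz.1.2 w hw).2 (Finset.mem_image_of_mem _ (by simp))
          (Finset.mem_image_of_mem _ (by simp))) hy
      · by_cases hij : j = i
        · simp [hij]
        · exact absurd (by simpa [Finset.pair_comm] using hadj j i hij) hy
    rw [key y hy, key y' hy']
  obtain ⟨e, he⟩ : ∃ e : Fin 4 ⊕ Fin 4 ≃ W, ⇑e = Sum.elim w u :=
    ⟨Equiv.ofBijective _ ((Fintype.bijective_iff_injective_and_card _).2 ⟨hinj, by simp [hcard]⟩),
      rfl⟩
  have hopp : ∀ x : Fin 4 ⊕ Fin 4, ({e x, e x.swap} : Finset W) ∉ L.faces := by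
    rintro (i | i)
    · simpa [he, Finset.pair_comm] using hnot i
    · simpa [he] using hnot i
  have hiff : ∀ x y, x ≠ y → (({e x, e y} : Finset W) ∈ L.faces ↔ y ≠ x.swap) := by
    intro x y hxy
    constructor
    · rintro h rfl
      exact hopp x h
    · intro h
      by_contra hns
      refine h (e.injective (hunique (e x) (e y) (e x.swap) (e.injective.ne hxy)
        (e.injective.ne ?_) hns (hopp x)))
      rcases x with x | x <;> simp
  classical
  -- `L` is now the boundary of the four-dimensional cross-polytope, with γ₂ = 16 - 64 + 96 - 64 +
  -- 16 = 0.
  have hf : ∀ i, L.fNum i = cliqueCount (fun x y : Fin 4 ⊕ Fin 4 => decide (y ≠ x.swap)) (i + 1)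
      ((List.finRange 4).map Sum.inl ++ (List.finRange 4).map Sum.inr) := by
    intro i
    have hnd : ((List.finRange 4).map Sum.inl ++ (List.finRange 4).map Sum.inr :
      List (Fin 4 ⊕ Fin 4)).Nodup := by decide
    rw [fNum_eq_cliqueCount hL (adj := fun x y => decide (({x, y} : Finset W) ∈ L.faces))
      (fun v w _ => by simp) (hnd.map e.injective), cliqueCount_map]
    · refine cliqueCount_congr _ hnd fun x _ y _ hxy => ?_
      simp only [hiff x y hxy]
    · intro v
      obtain ⟨x, rfl⟩ := e.surjective v
      exact List.mem_map_of_mem (by rcases x with x | x <;> simp)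
  have h3 : L.fNum 3 = 16 := by rw [hf]; decide +kernel
  have h2 : L.fNum 2 = 32 := by rw [hf]; decide +kernel
  have h1 : L.fNum 1 = 24 := by rw [hf]; decide +kernel
  have h0 : L.fNum 0 = 8 := by rw [hf]; decide +kernel
  rw [gammaTwo, h3, h2, h1, h0] at hγ
  norm_num at hγ

/-! ### Maps of nonzero degree -/

/-- `s` lies in a simplex with nonzero coefficient in the cycle of `L`; as `d ≠ 0`, this coefficient
must come from a simplex of `K` mapped onto it. -/
theorem HasDegree.exists_subset_image {V W : Type*} [Fintype V] [DecidableEq V] [Fintype W]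
    [DecidableEq W] {K : AbstractSimplicialComplex V} {L : AbstractSimplicialComplex W} {f : V → W}
    {d : ℤ} (hL : L.TriangulatesSphere 3) (hd : d ≠ 0) (h : K.HasDegree L 3 f d) {s : Finset W}
    (hs : s ∈ L.faces) : ∃ t ∈ K.faces, s ⊆ t.image f := by
  obtain ⟨z, z', hz, hz', hf⟩ := h
  obtain ⟨w, hw, hsw⟩ := exists_subset_of_isCycle hL hz'.1 hz'.2.1 hs
  have hne : pushforward f z w ≠ 0 := by
    rw [hf]
    simpa using ⟨hd, hw⟩
  obtain ⟨v, -, hv⟩ := Finset.exists_ne_zero_of_sum_ne_zero hne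
  by_cases hvw : f ∘ v = w
  · rw [if_pos hvw] at hv
    refine ⟨_, (hz.1.1.2 v hv).2, ?_⟩
    rwa [Finset.image_image, hvw]
  · exact absurd (if_neg hvw) hv

theorem injective_and_surjective_of_hasDegree {W : Type*} [Fintype W] [DecidableEq W]
    {L : AbstractSimplicialComplex W} (hL : L.IsPositiveFlagSphere) {f : Fin 12 → W}
    (hf : T12.IsSimplicialMap L f) {d : ℤ} (hd : d ≠ 0) (h : T12.HasDegree L 3 f d) :
    Function.Injective f ∧ ∀ s ∈ L.faces, ∃ t ∈ T12.faces, s ⊆ t.image f := by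
  obtain ⟨hflag, hsphere, hγ⟩ := hL
  have hcov : ∀ s ∈ L.faces, ∃ t ∈ T12.faces, s ⊆ t.image f := fun s hs =>
    h.exists_subset_image hsphere hd hs
  refine ⟨injective_of_gammaTwo_pos hflag hf hcov ?_ hγ, hcov⟩
  obtain ⟨z, z', -, hz', -⟩ := h
  exact nine_le_card hflag hz'.1 hz'.2.1
    (fun s hs => exists_subset_of_isCycle hsphere hz'.1 hz'.2.1 hs) hγ

theorem isomorphic_of_injective {V W : Type*} [DecidableEq W]
    {K : AbstractSimplicialComplex V} {L : AbstractSimplicialComplex W} {f : V → W}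
    (hf : K.IsSimplicialMap L f) (hinj : Function.Injective f)
    (hcov : ∀ s ∈ L.faces, ∃ t ∈ K.faces, s ⊆ t.image f) : K.Isomorphic L := by
  have hsurj : Function.Surjective f := by
    intro w
    obtain ⟨t, -, ht⟩ := hcov {w} (L.singleton_mem w)
    obtain ⟨v, -, hv⟩ := Finset.mem_image.1 (ht (Finset.mem_singleton_self w))
    exact ⟨v, hv⟩
  refine ⟨Equiv.ofBijective f ⟨hinj, hsurj⟩, fun s => ?_⟩
  have hs : s.map (Equiv.ofBijective f ⟨hinj, hsurj⟩).toEmbedding = s.image f :=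
    Finset.map_eq_image _ _
  rw [hs]
  refine ⟨hf s, fun h => ?_⟩
  obtain ⟨t, ht, hst⟩ := hcov _ h
  refine (K.isRelLowerSet_faces ht).2 ?_ (Finset.image_nonempty.1 (L.isRelLowerSet_faces h).1)
  exact (Finset.image_subset_image_iff hinj).1 hst

end AbstractSimplicialComplex

theorem proposition5p4 :
    AbstractSimplicialComplex.IsBasic.{u} AbstractSimplicialComplex.T12 ∧
    AbstractSimplicialComplex.gammaTwo AbstractSimplicialComplex.T12 = 1 ∧
    ¬ AbstractSimplicialComplex.Dominates 3
        AbstractSimplicialComplex.T12 AbstractSimplicialComplex.T10 := by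
  refine ⟨⟨AbstractSimplicialComplex.isPositiveFlagSphere_T12, ?_⟩, AbstractSimplicialComplex.gammaTwo_T12, ?_⟩
  · rintro W _ _ L hL ⟨f, hf, d, hd, h⟩
    obtain ⟨hinj, hcov⟩ := AbstractSimplicialComplex.injective_and_surjective_of_hasDegree hL hf hd h
    exact AbstractSimplicialComplex.isomorphic_of_injective hf hinj hcov
  · rintro ⟨f, hf, d, hd, h⟩
    -- The map would embed twelve vertices into ten.
    have := Fintype.card_le_of_injective f
      (AbstractSimplicialComplex.injective_and_surjective_of_hasDegree AbstractSimplicialComplex.isPositiveFlagSphere_T10 hf hd h).1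
    simp at this
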